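/- For $c\in\mathbb R$ let $M^2(c)$ be the complete simply connected surface of constant curvature $c$: the sphere $\{p\in\mathbb E^3:\langle p,p\rangle=1/c\}$ if $c>0$, the Euclidean plane if $c=0$, and the upper sheet ($p_1>0$) of the hyperboloid $\{p\in\mathbb R^3_1:\langle p,p\rangle_1=1/c\}$, $\langle\cdot,\cdot\rangle_1=-dp_1^2+dp_2^2+dp_3^2$, if $c<0$. Let $c_1,c_2\in\mathbb R$ be not both $0$, give $M^2(c_1)\times M^2(c_2)$ the product metric, and let $F(X_1+X_2)=X_1-X_2$ be its product structure, where $X_1,X_2$ are the parts tangent to the first and second factor. Let $\psi:M^2\to M^2(c_1)\times M^2(c_2)$ be a smooth immersion of a connected surface, with the induced metric, and for tangent $X$ let $fX$ be the tangential component of $FX$. Suppose that $f=\lambda I$ with a constant $\lambda\in[-1,1]$. Then $M^2$ is totally geodesic in $M^2(c_1)\times M^2(c_2)$, and one of the following holds. 1. $\lambda=1$, the Gaussian curvature of $M^2$ is $c_1$, and the surface is an open part of a slice $M^2(c_1)\times\{p_2\}$, $p_2\in M^2(c_2)$. 2. $\lambda=-1$, the Gaussian curvature of $M^2$ is $c_2$,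 and the surface is an open part of a slice $\{p_1\}\times M^2(c_2)$, $p_1\in M^2(c_1)$. 3. $c_1c_2>0$, $\lambda=\frac{c_2-c_1}{c_1+c_2}$, the Gaussian curvature of $M^2$ is $\frac{c_1c_2}{c_1+c_2}$, and every point of $M^2$ has a neighbourhood with smooth coordinates $(u,v)$ in which $\psi$ is, up to an isometry of $M^2(c_1)\times M^2(c_2)$, of the following form. Here $\alpha$ and $\beta$ are geodesics of $M^2(c_1)$ and $M^2(c_2)$ of constant speed $\sqrt{\frac{c_2}{c_1+c_2}}$ and $\sqrt{\frac{c_1}{c_1+c_2}}$, respectively. - If $c_1,c_2>0$, with $k=\sqrt{\frac{c_1c_2}{c_1+c_2}}$ and $\times$ the cross product of $\mathbb E^3$: $$\Big(\cos(ku)\,\alpha(v)+\sin(ku)\sqrt{\tfrac{c_1+c_2}{c_2}}\;\alpha(v)\times\alpha'(v),\ \cos(ku)\,\beta(v)+\sin(ku)\sqrt{\tfrac{c_1+c_2}{c_1}}\;\beta(v)\times\beta'(v)\Big).$$ - If $c_1,c_2<0$, with $k=\sqrt{-\frac{c_1c_2}{c_1+c_2}}$ and $\boxtimes$ the Lorentzian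 cross product of $\mathbb R^3_1$: $$\Big(\cosh(ku)\,\alpha(v)+\sinh(ku)\sqrt{\tfrac{c_1+c_2}{c_2}}\;\alpha(v)\boxtimes\alpha'(v),\ \cosh(ku)\,\beta(v)+\sinh(ku)\sqrt{\tfrac{c_1+c_2}{c_1}}\;\beta(v)\boxtimes\beta'(v)\Big).$$ -/

import Mathlib

open scoped Manifold ContDiff Matrix

noncomputable section

namespace ProductSurface

/-! ### The two-dimensional space forms `M²(c)` and their product -/

/-- The ambient three-space of the standard model of `M²(c)`. -/
abbrev R3 : Type := Fin 3 → ℝ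

/-- The ambient space `ℝ³ × ℝ³` of the product `M²(c₁) × M²(c₂)`. -/
abbrev Amb : Type := R3 × R3

/-- The coordinate plane on which surfaces are modelled. -/
abbrev R2 : Type := EuclideanSpace ℝ (Fin 2)

/-- The coordinate vectors of the plane. -/
def e (i : Fin 2) : R2 := EuclideanSpace.single i 1

/-- The scalar product of the ambient three-space: the Lorentzian one `-,+,+` if `c < 0`, the
Euclidean one if `c ≥ 0`. -/
def form (c : ℝ) (v w : R3) : ℝ :=
  (if c < 0 then -1 else 1) * (v 0 * w 0) + v 1 * w 1 + v 2 * w 2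

/-- The complete simply connected surface `M²(c)` of constant curvature `c`: the sphere
`⟨p, p⟩ = 1 / c` if `c > 0`, the upper sheet of the hyperboloid `⟨p, p⟩ = 1 / c` if `c < 0`, and
the Euclidean plane, realised as the plane `p 0 = 0` of Euclidean three-space, if `c = 0`. -/
def spaceForm (c : ℝ) : Set R3 :=
  {p | if c = 0 then p 0 = 0 else form c p p = 1 / c ∧ (c < 0 → 0 < p 0)}

/-- A vector spanning the normal line of `M²(c)` in the ambient three-space at `p`. -/
def normalVec (c : ℝ) (p : R3) : R3 := if c = 0 then ![1, 0, 0] else p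

/-- The orthogonal projection of the ambient three-space onto the tangent plane of `M²(c)`
at `p`. -/
def tangentProj (c : ℝ) (p v : R3) : R3 :=
  v - (form c (normalVec c p) v / form c (normalVec c p) (normalVec c p)) • normalVec c p

/-- The subset `M²(c₁) × M²(c₂)` of `ℝ³ × ℝ³`. -/
def productForm (c₁ c₂ : ℝ) : Set Amb := spaceForm c₁ ×ˢ spaceForm c₂

/-- The product metric. -/
def prodMetric (c₁ c₂ : ℝ) (v w : Amb) : ℝ := form c₁ v.1 w.1 + form c₂ v.2 w.2

/-- The projection of `ℝ³ × ℝ³` onto the tangent space of `M²(c₁) × M²(c₂)` at `p`; the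
Levi-Civita connection of the product is this projection of the ambient derivative. -/
def prodTangentProj (c₁ c₂ : ℝ) (p v : Amb) : Amb :=
  (tangentProj c₁ p.1 v.1, tangentProj c₂ p.2 v.2)

/-- The product structure `F (X₁ + X₂) = X₁ - X₂`. -/
def prodStructure (v : Amb) : Amb := (v.1, -v.2)

/-! ### Surfaces immersed in the product -/

section Surface

variable {M : Type*} [TopologicalSpace M] [ChartedSpace R2 M]

/-- The differential of `ψ : M → ℝ³ × ℝ³` at `p`. -/
def dpsi (ψ : M → Amb) (p : M) : TangentSpace (𝓡 2) p →L[ℝ] Amb :=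
  mfderiv (𝓡 2) 𝓘(ℝ, Amb) ψ p

/-- `ψ` is a smooth immersion of the surface `M` in `M²(c₁) × M²(c₂)`. -/
structure IsImmersedSurface (c₁ c₂ : ℝ) (ψ : M → Amb) : Prop where
  smooth : ContMDiff (𝓡 2) 𝓘(ℝ, Amb) ∞ ψ
  mem : ∀ p, ψ p ∈ productForm c₁ c₂
  immersion : ∀ p, Function.Injective (dpsi ψ p)

/-- The induced metric `g` on `M`. -/
def inducedMetric (c₁ c₂ : ℝ) (ψ : M → Amb) (p : M) (X Y : TangentSpace (𝓡 2) p) : ℝ :=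
  prodMetric c₁ c₂ (dpsi ψ p X) (dpsi ψ p Y)

/-- The Gram matrix of the induced metric at `p` in the coordinate basis of `T_p M`. -/
def gram (c₁ c₂ : ℝ) (ψ : M → Amb) (p : M) : Matrix (Fin 2) (Fin 2) ℝ :=
  Matrix.of fun i j => inducedMetric c₁ c₂ ψ p (e i) (e j)

/-- The tangential component of `W` along `ψ` at `p`: the vector
`∑ i j, g^{ij} ⟨W, dψ eⱼ⟩ eᵢ` of `T_p M`, that is, the vector `Z` of `T_p M` for which `W - dψ Z`
is orthogonal to the surface. -/
def tangentPart (c₁ c₂ : ℝ) (ψ : M → Amb) (p : M) (W : Amb) : TangentSpace (𝓡 2) p :=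
  WithLp.toLp 2 ((gram c₁ c₂ ψ p)⁻¹ *ᵥ fun j => prodMetric c₁ c₂ W (dpsi ψ p (e j)))

/-- The component of `W` normal to the surface. -/
def normalPart (c₁ c₂ : ℝ) (ψ : M → Amb) (p : M) (W : Amb) : Amb :=
  W - dpsi ψ p (tangentPart c₁ c₂ ψ p W)

/-- The tensor `f` of the surface: `f X` is the tangential component of `F X`. -/
def tensorF (c₁ c₂ : ℝ) (ψ : M → Amb) (p : M) (X : TangentSpace (𝓡 2) p) :
    TangentSpace (𝓡 2) p :=
  tangentPart c₁ c₂ ψ p (prodStructure (dpsi ψ p X))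

/-- The immersion read in the coordinates given by the preferred chart at `p`. -/
def localRep (ψ : M → Amb) (p : M) : R2 → Amb := ψ ∘ (extChartAt (𝓡 2) p).symm

/-- The second fundamental form `σ (X, Y)` at `p`: the component normal to the surface of the
covariant derivative in `M²(c₁) × M²(c₂)`, in the direction `X`, of `dψ Y`, where `Y` is extended
with constant coefficients in the chart at `p`. -/
def secondFundForm (c₁ c₂ : ℝ) (ψ : M → Amb) (p : M) (X Y : R2) : Amb :=
  normalPart c₁ c₂ ψ p
    (prodTangentProj c₁ c₂ (ψ p)
      (fderiv ℝ (fun x => fderiv ℝ (localRep ψ p) x Y) (extChartAt (𝓡 2) p p) X))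

/-- The surface is totally geodesic. -/
def IsTotallyGeodesic (c₁ c₂ : ℝ) (ψ : M → Amb) : Prop :=
  ∀ p X Y, secondFundForm c₁ c₂ ψ p X Y = 0

end Surface

/-! ### Gaussian curvature of a metric in coordinates -/

/-- The partial derivative `∂ₖ u` at `x`. -/
def partialDeriv (k : Fin 2) (u : R2 → ℝ) (x : R2) : ℝ := fderiv ℝ u x (e k)

/-- The Christoffel symbol `Γᵏᵢⱼ` of the metric `G`. -/
def christoffel (G : R2 → Matrix (Fin 2) (Fin 2) ℝ) (i j k : Fin 2) (x : R2) : ℝ :=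
  1 / 2 * ∑ l, (G x)⁻¹ k l *
    (partialDeriv i (fun y => G y j l) x + partialDeriv j (fun y => G y i l) x
      - partialDeriv l (fun y => G y i j) x)

/-- The coefficient of `∂ₗ` in `R(∂ᵢ, ∂ⱼ)∂ₖ`, where `R(X, Y) = ∇_X ∇_Y - ∇_Y ∇_X - ∇_[X, Y]`. -/
def riemann (G : R2 → Matrix (Fin 2) (Fin 2) ℝ) (i j k l : Fin 2) (x : R2) : ℝ :=
  partialDeriv i (christoffel G j k l) x - partialDeriv j (christoffel G i k l) x
    + ∑ m, (christoffel G j k m x * christoffel G i m l x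
      - christoffel G i k m x * christoffel G j m l x)

/-- The Gaussian curvature `g(R(∂₀, ∂₁)∂₁, ∂₀) / det g` of the metric `G`. -/
def curvatureOfMetric (G : R2 → Matrix (Fin 2) (Fin 2) ℝ) (x : R2) : ℝ :=
  (∑ l, riemann G 0 1 1 l x * G x l 0) / (G x).det

section Surface

variable {M : Type*} [TopologicalSpace M] [ChartedSpace R2 M]

/-- The coefficients of the induced metric in the coordinates given by the chart at `p`. -/
def metricInChart (c₁ c₂ : ℝ) (ψ : M → Amb) (p : M) (x : R2) : Matrix (Fin 2) (Fin 2) ℝ :=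
  Matrix.of fun i j => prodMetric c₁ c₂ (fderiv ℝ (localRep ψ p) x (e i))
    (fderiv ℝ (localRep ψ p) x (e j))

/-- The Gaussian curvature at `p` of `M` with the induced metric. -/
def gaussCurvature (c₁ c₂ : ℝ) (ψ : M → Amb) (p : M) : ℝ :=
  curvatureOfMetric (metricInChart c₁ c₂ ψ p) (extChartAt (𝓡 2) p p)

/-- `ψ` maps into `S` and is open as a map to `S`. For an immersed surface and a slice `S`, the
surface is an open part of `S`. -/
def IsOpenPart (ψ : M → Amb) (S : Set Amb) : Prop :=
  ∀ U : Set M, IsOpen U → ∃ V : Set Amb, IsOpen V ∧ ψ '' U = V ∩ S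

end Surface

/-! ### The model surfaces -/

/-- The Lorentzian cross product of `ℝ³` with the scalar product `-,+,+`. -/
def lorentzCross (v w : R3) : R3 :=
  ![-(v 1 * w 2 - v 2 * w 1), v 2 * w 0 - v 0 * w 2, v 0 * w 1 - v 1 * w 0]

/-- `γ` is a geodesic of `M²(c)` of constant speed `s`. -/
structure IsGeodesicOfSpeed (c s : ℝ) (γ : ℝ → R3) : Prop where
  smooth : ContDiff ℝ ∞ γ
  mem : ∀ t, γ t ∈ spaceForm c
  geodesic : ∀ t, tangentProj c (γ t) (deriv (deriv γ) t) = 0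
  speed : ∀ t, √(form c (deriv γ t) (deriv γ t)) = s

/-- The surface, parametrized by `(u, v)`, spanned by two curves `α` in `M²(c₁)` and `β` in
`M²(c₂)`, for `c₁, c₂ > 0`. -/
def sphericalModel (c₁ c₂ : ℝ) (α β : ℝ → R3) (u v : ℝ) : Amb :=
  (Real.cos (√(c₁ * c₂ / (c₁ + c₂)) * u) • α v
      + (Real.sin (√(c₁ * c₂ / (c₁ + c₂)) * u) * √((c₁ + c₂) / c₂)) •
        crossProduct (α v) (deriv α v),
    Real.cos (√(c₁ * c₂ / (c₁ + c₂)) * u) • β v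
      + (Real.sin (√(c₁ * c₂ / (c₁ + c₂)) * u) * √((c₁ + c₂) / c₁)) •
        crossProduct (β v) (deriv β v))

/-- The surface, parametrized by `(u, v)`, spanned by two curves `α` in `M²(c₁)` and `β` in
`M²(c₂)`, for `c₁, c₂ < 0`. -/
def hyperbolicModel (c₁ c₂ : ℝ) (α β : ℝ → R3) (u v : ℝ) : Amb :=
  (Real.cosh (√(-(c₁ * c₂ / (c₁ + c₂))) * u) • α v
      + (Real.sinh (√(-(c₁ * c₂ / (c₁ + c₂))) * u) * √((c₁ + c₂) / c₂)) •
        lorentzCross (α v) (deriv α v),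
    Real.cosh (√(-(c₁ * c₂ / (c₁ + c₂))) * u) • β v
      + (Real.sinh (√(-(c₁ * c₂ / (c₁ + c₂))) * u) * √((c₁ + c₂) / c₁)) •
        lorentzCross (β v) (deriv β v))

/-- `τ` is an affine map of the ambient three-space whose linear part preserves the scalar product
and which maps `M²(c)` onto itself. The isometries of `M²(c)` are the restrictions of such maps. -/
def IsSpaceFormIsometry (c : ℝ) (τ : R3 ≃ᵃ[ℝ] R3) : Prop :=
  (∀ v w, form c (τ.linear v) (τ.linear w) = form c v w) ∧ τ '' spaceForm c = spaceForm c

/-- Near every point there are smooth coordinates `(u, v)` of `M` in which `ψ`, up to an isometry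
`τ₁ × τ₂` of `M²(c₁) × M²(c₂)`, is given by `Φ α β u v`, where `α` and `β` are geodesics of `M²(c₁)`
and `M²(c₂)` of constant speed `√(c₂ / (c₁ + c₂))` and `√(c₁ / (c₁ + c₂))`. -/
def IsLocallyCongruentTo {M : Type*} [TopologicalSpace M] [ChartedSpace R2 M]
    (c₁ c₂ : ℝ) (ψ : M → Amb) (Φ : (ℝ → R3) → (ℝ → R3) → ℝ → ℝ → Amb) : Prop :=
  ∀ p : M, ∃ χ ∈ IsManifold.maximalAtlas (𝓡 2) ∞ M, p ∈ χ.source ∧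
    ∃ τ₁ τ₂ : R3 ≃ᵃ[ℝ] R3, IsSpaceFormIsometry c₁ τ₁ ∧ IsSpaceFormIsometry c₂ τ₂ ∧
    ∃ α β : ℝ → R3, IsGeodesicOfSpeed c₁ (√(c₂ / (c₁ + c₂))) α ∧
      IsGeodesicOfSpeed c₂ (√(c₁ / (c₁ + c₂))) β ∧
      ∀ q ∈ χ.source, (τ₁ (ψ q).1, τ₂ (ψ q).2) = Φ α β (χ q 0) (χ q 1)

end ProductSurface

end

open scoped Manifold ContDiff Matrix

noncomputable section

namespace ProductSurface

/-! ### Linear algebra of the scalar product -/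

/-! Write `ψ = (φ₁, φ₂)` and let `g` be the induced metric. The pullbacks of the two factor metrics
add up to `g`, and `f = λ I` says that their difference is `λ g`. So `φ₁` and `φ₂` are homothetic,
with factors `a₁ = (1 + λ)/2` and `a₂ = (1 - λ)/2` (`form_dpsi_of_tensorF_eq`,
`isHomothetic_localRep`). Everything else concerns a map of a surface into `M²(c)` that induces `a
g`.

If `a ≠ 0`, such a map is a local diffeomorphism, and its Gauss formula (`gauss_formula`) involves
only the Christoffel symbols of `g` and the product `c a`. If `a = 0`, its derivative vanishes. In
both cases the covariant derivative of `dφ Y` along `X` is `dφ (∇_X Y)`, with the same `∇` for both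
factors. Hence the covariant derivative of `dψ Y` is tangent to the surface, which is therefore
totally geodesic.

The Gauss equation gives `g` the curvature `c a` whenever `a ≠ 0` (`curvature_eq`). For `λ = ±1` one
component is constant by connectedness and the other is locally open, so the surface is an open part
of a slice. Otherwise both factors compute the same curvature, `c₁ a₁ = c₂ a₂`. Since `c₁, c₂` are
not both zero, they have the same sign, and `λ` is determined.

In this last case the frames `(φᵢ, ∂₀ φᵢ, ∂₁ φᵢ)` solve the same linear system, so they differ by a
constant linear map `C`, and `φ₂ = C φ₁` (`exists_linear`). The map `C` multiplies the scalar
product by `c₁ / c₂`. Up to an isometry of the second factor, the surface is thus locally the graph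
of multiplication by `√(c₁ / c₂)`. The models are this graph over the coordinates of `M²(c₁)` formed
by a geodesic and the geodesics orthogonal to it. -/

lemma form_comm (c : ℝ) (v w : R3) : form c v w = form c w v := by
  simp only [form]; ring

lemma form_add_left (c : ℝ) (u v w : R3) : form c (u + v) w = form c u w + form c v w := by
  simp only [form, Pi.add_apply]; ring

lemma form_add_right (c : ℝ) (u v w : R3) : form c u (v + w) = form c u v + form c u w := by
  simp only [form, Pi.add_apply]; ring

lemma form_smul_left (c r : ℝ) (v w : R3) : form c (r • v) w = r * form c v w := by
  simp only [form, Pi.smul_apply, smul_eq_mul]; ring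

lemma form_smul_right (c r : ℝ) (v w : R3) : form c v (r • w) = r * form c v w := by
  simp only [form, Pi.smul_apply, smul_eq_mul]; ring

lemma form_sub_left (c : ℝ) (u v w : R3) : form c (u - v) w = form c u w - form c v w := by
  simp only [form, Pi.sub_apply]; ring

lemma form_sub_right (c : ℝ) (u v w : R3) : form c u (v - w) = form c u v - form c u w := by
  simp only [form, Pi.sub_apply]; ring

lemma form_neg_left (c : ℝ) (v w : R3) : form c (-v) w = -form c v w := by
  simp only [form, Pi.neg_apply]; ring

lemma form_zero_left (c : ℝ) (w : R3) : form c 0 w = 0 := by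
  simp [form]

lemma form_zero_right (c : ℝ) (w : R3) : form c w 0 = 0 := by
  simp [form]

lemma form_nondegenerate {c : ℝ} {v : R3} (h : ∀ w, form c v w = 0) : v = 0 := by
  have h0 := h ![1, 0, 0]
  have h1 := h ![0, 1, 0]
  have h2 := h ![0, 0, 1]
  simp only [form, Matrix.cons_val_zero, Matrix.cons_val_one, Matrix.cons_val] at h0 h1 h2
  ext i
  fin_cases i
  · split_ifs at h0 <;> simpa using h0
  · simpa using h1
  · simpa using h2

/-- The tangent vectors `v` of `M²(c)` at `p`. -/
def IsTangent (c : ℝ) (p v : R3) : Prop := form c (normalVec c p) v = 0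

lemma normalVec_eq_self {c : ℝ} (hc : c ≠ 0) (p : R3) : normalVec c p = p := if_neg hc

lemma mem_spaceForm_zero {p : R3} : p ∈ spaceForm 0 ↔ p 0 = 0 := by simp [spaceForm]

lemma form_self_of_mem {c : ℝ} (hc : c ≠ 0) {p : R3} (hp : p ∈ spaceForm c) :
    form c p p = 1 / c := by
  simp only [spaceForm, Set.mem_ofPred_eq, if_neg hc] at hp
  exact hp.1

lemma apply_zero_pos_of_mem {c : ℝ} (hc : c < 0) {p : R3} (hp : p ∈ spaceForm c) : 0 < p 0 := by
  simp only [spaceForm, Set.mem_ofPred_eq, if_neg hc.ne] at hp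
  exact hp.2 hc

lemma form_normalVec_ne_zero {c : ℝ} {p : R3} (hp : p ∈ spaceForm c) :
    form c (normalVec c p) (normalVec c p) ≠ 0 := by
  by_cases hc : c = 0
  · subst hc; simp [normalVec, form]
  · rw [normalVec_eq_self hc, form_self_of_mem hc hp]
    simpa using hc

lemma tangentProj_of_isTangent {c : ℝ} {p v : R3} (hv : IsTangent c p v) :
    tangentProj c p v = v := by
  simp only [IsTangent] at hv
  simp [tangentProj, hv]

/-- Only `c < 0` needs tangency: the orthogonal complement of a timelike vector is spacelike. The
identity `key` eliminates `v 0` by tangency and is then Lagrange's identity in the last two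
coordinates. -/
lemma IsTangent.form_self_nonneg_and_eq_zero {c : ℝ} {p v : R3} (hp : p ∈ spaceForm c)
    (hv : IsTangent c p v) : 0 ≤ form c v v ∧ (form c v v = 0 → v = 0) := by
  by_cases hc : c < 0
  · have h1 := form_self_of_mem hc.ne hp
    have h0 := apply_zero_pos_of_mem hc hp
    have hk : 1 / c < 0 := one_div_neg.2 hc
    simp only [IsTangent, normalVec_eq_self hc.ne] at hv
    simp only [form, if_pos hc] at *
    set κ := 1 / c
    have key : p 0 * p 0 * (-1 * (v 0 * v 0) + v 1 * v 1 + v 2 * v 2) =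
        -κ * (v 1 ^ 2 + v 2 ^ 2) + (v 1 * p 2 - v 2 * p 1) ^ 2 := by
      have e1 : p 0 * v 0 = p 1 * v 1 + p 2 * v 2 := by linarith
      have e2 : p 0 * p 0 = p 1 * p 1 + p 2 * p 2 - κ := by linarith
      linear_combination (v 1 * v 1 + v 2 * v 2) * e2 - (p 0 * v 0 + p 1 * v 1 + p 2 * v 2) * e1
    have hpp : 0 < p 0 * p 0 := mul_pos h0 h0
    have hs : 0 ≤ -κ * (v 1 ^ 2 + v 2 ^ 2) := mul_nonneg (by linarith) (by positivity)
    constructor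
    · by_contra! hneg
      have := mul_neg_of_pos_of_neg hpp hneg
      nlinarith [sq_nonneg (v 1 * p 2 - v 2 * p 1)]
    · intro hz
      rw [hz, mul_zero] at key
      have h3 : -κ * (v 1 ^ 2 + v 2 ^ 2) = 0 := by
        nlinarith [sq_nonneg (v 1 * p 2 - v 2 * p 1)]
      have h4 : v 1 ^ 2 + v 2 ^ 2 = 0 := (mul_eq_zero.1 h3).resolve_left (by linarith)
      have h5 : v 1 = 0 := by nlinarith [sq_nonneg (v 1), sq_nonneg (v 2)]
      have h6 : v 2 = 0 := by nlinarith [sq_nonneg (v 1), sq_nonneg (v 2)]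
      have h7 : v 0 = 0 := by
        rw [h5, h6] at hv
        have : p 0 * v 0 = 0 := by linarith
        exact (mul_eq_zero.1 this).resolve_left h0.ne'
      ext i; fin_cases i <;> simpa
  · simp only [form, if_neg hc, one_mul]
    constructor
    · nlinarith [mul_self_nonneg (v 0), mul_self_nonneg (v 1), mul_self_nonneg (v 2)]
    · intro hz
      ext i
      fin_cases i <;> simp only [Fin.zero_eta, Fin.mk_one, Fin.reduceFinMk, Pi.zero_apply] <;>
        nlinarith [mul_self_nonneg (v 0), mul_self_nonneg (v 1), mul_self_nonneg (v 2)]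

lemma IsTangent.form_self_nonneg {c : ℝ} {p v : R3} (hp : p ∈ spaceForm c)
    (hv : IsTangent c p v) : 0 ≤ form c v v :=
  (hv.form_self_nonneg_and_eq_zero hp).1

lemma IsTangent.eq_zero {c : ℝ} {p v : R3} (hp : p ∈ spaceForm c)
    (hv : IsTangent c p v) (h : form c v v = 0) : v = 0 :=
  (hv.form_self_nonneg_and_eq_zero hp).2 h

lemma IsTangent.sub {c : ℝ} {p v w : R3} (hv : IsTangent c p v) (hw : IsTangent c p w) :
    IsTangent c p (v - w) := by
  simp only [IsTangent, form_sub_right] at *; rw [hv, hw, sub_self]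

lemma IsTangent.add {c : ℝ} {p v w : R3} (hv : IsTangent c p v) (hw : IsTangent c p w) :
    IsTangent c p (v + w) := by
  simp only [IsTangent, form_add_right] at *; rw [hv, hw, add_zero]

lemma IsTangent.smul {c : ℝ} {p v : R3} (hv : IsTangent c p v) (r : ℝ) :
    IsTangent c p (r • v) := by
  simp only [IsTangent, form_smul_right] at *; rw [hv, mul_zero]

/-- The map `(X, t) ↦ A X + t n`, for an injective map `A` of the plane to a tangent plane. -/
lemma injective_add_smul_normalVec {c : ℝ} {p : R3} (hp : p ∈ spaceForm c) (A : R2 →L[ℝ] R3)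
    (hA : Function.Injective A) (ht : ∀ X, IsTangent c p (A X)) :
    Function.Injective (A.coprod (ContinuousLinearMap.toSpanSingleton ℝ (normalVec c p))) := by
  rw [injective_iff_map_eq_zero]
  rintro ⟨X, t⟩ h
  simp only [ContinuousLinearMap.coprod_apply, ContinuousLinearMap.toSpanSingleton_apply] at h
  have h1 : form c (normalVec c p) (A X + t • normalVec c p) = 0 := by
    rw [h, form_zero_right]
  rw [form_add_right, ht X, form_smul_right, zero_add] at h1
  have h2 : t = 0 := (mul_eq_zero.1 h1).resolve_right (form_normalVec_ne_zero hp)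
  subst h2
  rw [zero_smul, add_zero] at h
  rw [(injective_iff_map_eq_zero A).1 hA X h]
  rfl

lemma finrank_R2_prod_real : Module.finrank ℝ (R2 × ℝ) = Module.finrank ℝ R3 := by
  simp [R2, R3, Module.finrank_prod]

/-- By the dimension count, `A` together with the normal line fills the three-space. Pairing with
the normal vector shows that a tangent vector has no normal component. -/
lemma exists_eq_of_isTangent {c : ℝ} {p : R3} (hp : p ∈ spaceForm c) (A : R2 →L[ℝ] R3)
    (hA : Function.Injective A) (ht : ∀ X, IsTangent c p (A X)) {v : R3} (hv : IsTangent c p v) :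
    ∃ X, A X = v := by
  have hs : Function.Surjective
      (A.coprod (ContinuousLinearMap.toSpanSingleton ℝ (normalVec c p))) :=
    (LinearMap.injective_iff_surjective_of_finrank_eq_finrank
      (f := (A.coprod (ContinuousLinearMap.toSpanSingleton ℝ (normalVec c p))).toLinearMap)
      finrank_R2_prod_real).1 (injective_add_smul_normalVec hp A hA ht)
  obtain ⟨⟨X, t⟩, h⟩ := hs v
  simp only [ContinuousLinearMap.coprod_apply, ContinuousLinearMap.toSpanSingleton_apply] at h
  have h1 : form c (normalVec c p) (A X + t • normalVec c p) = 0 := by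
    rw [h]; exact hv
  rw [form_add_right, ht X, form_smul_right, zero_add] at h1
  have h2 : t = 0 := (mul_eq_zero.1 h1).resolve_right (form_normalVec_ne_zero hp)
  exact ⟨X, by rw [← h, h2, zero_smul, add_zero]⟩

/-! ### Derivatives of scalar products -/

section Calculus

variable {f g : R2 → R3} {x : R2}

lemma fderiv_form_apply (c : ℝ) (hf : DifferentiableAt ℝ f x) (hg : DifferentiableAt ℝ g x)
    (X : R2) : fderiv ℝ (fun y => form c (f y) (g y)) x X =
      form c (fderiv ℝ f x X) (g x) + form c (f x) (fderiv ℝ g x X) := by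
  have hf' := hasFDerivAt_pi'.1 hf.hasFDerivAt
  have hg' := hasFDerivAt_pi'.1 hg.hasFDerivAt
  have h := ((((hf' 0).mul (hg' 0)).const_mul (if c < 0 then (-1 : ℝ) else 1)).add
    ((hf' 1).mul (hg' 1))).add ((hf' 2).mul (hg' 2))
  have h2 : HasFDerivAt (fun y => form c (f y) (g y)) _ x := h
  rw [h2.fderiv]
  by_cases hc : c < 0 <;> simp [form, hc] <;> ring

lemma ContDiffAt.form {n : ℕ∞ω} (c : ℝ) (hf : ContDiffAt ℝ n f x) (hg : ContDiffAt ℝ n g x) :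
    ContDiffAt ℝ n (fun y => ProductSurface.form c (f y) (g y)) x := by
  rw [contDiffAt_pi] at hf hg
  exact ((contDiffAt_const.mul ((hf 0).mul (hg 0))).add ((hf 1).mul (hg 1))).add
    ((hf 2).mul (hg 2))

end Calculus

lemma contDiffAt_fderiv_apply {E : Type*} [NormedAddCommGroup E] [NormedSpace ℝ E] {φ : R2 → E}
    {x : R2} (h : ContDiffAt ℝ ∞ φ x) (X : R2) :
    ContDiffAt ℝ ∞ (fun y => fderiv ℝ φ y X) x :=
  (h.fderiv_right (m := ∞) (by norm_cast)).clm_apply contDiffAt_const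

lemma fderiv_fderiv_apply_comm {E : Type*} [NormedAddCommGroup E] [NormedSpace ℝ E] {φ : R2 → E}
    {x : R2} (h : ContDiffAt ℝ ∞ φ x) (X Y : R2) :
    fderiv ℝ (fun y => fderiv ℝ φ y X) x Y = fderiv ℝ (fun y => fderiv ℝ φ y Y) x X := by
  have hd : DifferentiableAt ℝ (fderiv ℝ φ) x :=
    (h.fderiv_right (m := 1) (by norm_cast)).differentiableAt (by norm_num)
  have hs := h.isSymmSndFDerivAt (by
    rw [minSmoothness_of_isRCLikeNormedField]
    exact WithTop.coe_le_coe.2 (le_top : (2 : ℕ∞) ≤ ⊤)) X Y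
  rw [fderiv_clm_apply hd (differentiableAt_const _), fderiv_clm_apply hd (differentiableAt_const _)]
  simp [hs]

lemma eq_sum_e (X : R2) : X = X 0 • e 0 + X 1 • e 1 := by
  ext i; fin_cases i <;> simp [e]

/-! ### Homothetic immersions into space forms -/

/-- This is the derivative of the defining equation of `M²(c)`. -/
lemma isTangent_fderiv {c : ℝ} {φ : R2 → R3} {x : R2} (h : ∀ᶠ y in nhds x, φ y ∈ spaceForm c)
    (hd : DifferentiableAt ℝ φ x) (X : R2) :
    IsTangent c (φ x) (fderiv ℝ φ x X) := by
  by_cases hc : c = 0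
  · subst hc
    have h1 : (fun y => form 0 ![1, 0, 0] (φ y)) =ᶠ[nhds x] fun _ => 0 := by
      filter_upwards [h] with y hy
      have := mem_spaceForm_zero.1 hy
      simp [form, this]
    have h2 := fderiv_form_apply 0 (differentiableAt_const (![1, 0, 0] : R3)) hd X
    rw [h1.fderiv_eq] at h2
    simpa [form_zero_left, IsTangent, normalVec] using h2.symm
  · have h1 : (fun y => form c (φ y) (φ y)) =ᶠ[nhds x] fun _ => 1 / c := by
      filter_upwards [h] with y hy
      exact form_self_of_mem hc hy
    have h2 := fderiv_form_apply c hd hd X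
    rw [h1.fderiv_eq, form_comm c (fderiv ℝ φ x X)] at h2
    simp only [fderiv_fun_const, Pi.zero_apply, zero_apply] at h2
    rw [IsTangent, normalVec_eq_self hc]
    linarith

/-- `φ` maps the open set `U` into `M²(c)` and induces there the metric `a G`. -/
structure IsHomothetic (c a : ℝ) (G : R2 → Matrix (Fin 2) (Fin 2) ℝ) (φ : R2 → R3)
    (U : Set R2) : Prop where
  isOpen : IsOpen U
  smooth : ∀ x ∈ U, ContDiffAt ℝ ∞ φ x
  mem : ∀ x ∈ U, φ x ∈ spaceForm c
  metric : ∀ x ∈ U, ∀ i j, form c (fderiv ℝ φ x (e i)) (fderiv ℝ φ x (e j)) = a * G x i j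
  det_ne_zero : ∀ x ∈ U, (G x).det ≠ 0

/-- The second derivative `∂ᵢ ∂ⱼ φ`. -/
def secondDeriv (φ : R2 → R3) (i j : Fin 2) (x : R2) : R3 :=
  fderiv ℝ (fun y => fderiv ℝ φ y (e j)) x (e i)

namespace IsHomothetic

variable {c a : ℝ} {G : R2 → Matrix (Fin 2) (Fin 2) ℝ} {φ : R2 → R3} {U : Set R2} {x : R2}

lemma eventually_mem (h : IsHomothetic c a G φ U) (hx : x ∈ U) : ∀ᶠ y in nhds x, y ∈ U :=
  h.isOpen.mem_nhds hx

lemma differentiableAt (h : IsHomothetic c a G φ U) (hx : x ∈ U) : DifferentiableAt ℝ φ x :=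
  (h.smooth x hx).differentiableAt (by simp)

lemma differentiableAt_fderiv_apply (h : IsHomothetic c a G φ U) (hx : x ∈ U) (X : R2) :
    DifferentiableAt ℝ (fun y => fderiv ℝ φ y X) x :=
  (contDiffAt_fderiv_apply (h.smooth x hx) X).differentiableAt (by simp)

lemma isTangent (h : IsHomothetic c a G φ U) (hx : x ∈ U) (X : R2) :
    IsTangent c (φ x) (fderiv ℝ φ x X) :=
  isTangent_fderiv ((h.eventually_mem hx).mono h.mem) (h.differentiableAt hx) X

/-- The factor `c` keeps the relation valid in the flat case, where the position vector is not
normal. The same device makes one Gauss formula serve all signs of `c`. -/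
lemma mul_form_fderiv (h : IsHomothetic c a G φ U) (hx : x ∈ U) (X : R2) :
    c * form c (φ x) (fderiv ℝ φ x X) = 0 := by
  by_cases hc : c = 0
  · rw [hc, zero_mul]
  · have := h.isTangent hx X
    rw [IsTangent, normalVec_eq_self hc] at this
    rw [this, mul_zero]

/-- Differentiating `⟨φ, ∂ⱼ φ⟩ = 0` gives `⟨φ, ∂ᵢ ∂ⱼ φ⟩ = -a Gᵢⱼ`, and `⟨φ, φ⟩ = 1 / c` turns this
into the multiple of `φ` to be added. It vanishes for `c = 0`. -/
lemma isTangent_secondDeriv (h : IsHomothetic c a G φ U) (hx : x ∈ U) (i j : Fin 2) :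
    IsTangent c (φ x) (secondDeriv φ i j x + (c * a * G x i j) • φ x) := by
  have hd := h.differentiableAt hx
  have hd' := h.differentiableAt_fderiv_apply hx (e j)
  by_cases hc : c = 0
  · subst hc
    have h1 : (fun y => form 0 ![1, 0, 0] (fderiv ℝ φ y (e j))) =ᶠ[nhds x] fun _ => 0 := by
      filter_upwards [h.eventually_mem hx] with y hy
      simpa [IsTangent, normalVec] using h.isTangent hy (e j)
    have h2 := fderiv_form_apply 0 (differentiableAt_const (![1, 0, 0] : R3)) hd' (e i)
    rw [h1.fderiv_eq] at h2
    simpa [form_zero_left, IsTangent, normalVec, secondDeriv] using h2.symm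
  · have h1 : (fun y => form c (φ y) (fderiv ℝ φ y (e j))) =ᶠ[nhds x] fun _ => 0 := by
      filter_upwards [h.eventually_mem hx] with y hy
      simpa [IsTangent, normalVec_eq_self hc] using h.isTangent hy (e j)
    have h2 := fderiv_form_apply c hd hd' (e i)
    rw [h1.fderiv_eq, h.metric x hx] at h2
    simp only [fderiv_fun_const, Pi.zero_apply, zero_apply] at h2
    rw [IsTangent, normalVec_eq_self hc, form_add_right, form_smul_right,
      form_self_of_mem hc (h.mem x hx), secondDeriv]
    field_simp
    linarith

lemma secondDeriv_comm (h : IsHomothetic c a G φ U) (hx : x ∈ U) (i j : Fin 2) :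
    secondDeriv φ i j x = secondDeriv φ j i x :=
  fderiv_fderiv_apply_comm (h.smooth x hx) (e j) (e i)

lemma symm (h : IsHomothetic c a G φ U) (ha : a ≠ 0) (hx : x ∈ U) (i j : Fin 2) :
    G x i j = G x j i := by
  apply mul_left_cancel₀ ha
  rw [← h.metric x hx, form_comm, h.metric x hx]

lemma form_fderiv (h : IsHomothetic c a G φ U) (hx : x ∈ U) (X Y : R2) :
    form c (fderiv ℝ φ x X) (fderiv ℝ φ x Y) = a * ∑ i, ∑ j, X i * Y j * G x i j := by
  rw [eq_sum_e X, eq_sum_e Y]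
  simp only [map_add, map_smul, form_add_left, form_add_right, form_smul_left, form_smul_right,
    h.metric x hx, Fin.sum_univ_two]
  simp [e]
  ring

lemma injective (h : IsHomothetic c a G φ U) (ha : a ≠ 0) (hx : x ∈ U) :
    Function.Injective (fderiv ℝ φ x) := by
  rw [injective_iff_map_eq_zero]
  intro X hX
  have h1 : Matrix.vecMul (X : Fin 2 → ℝ) (G x) = 0 := by
    ext j
    have h2 := h.form_fderiv hx X (e j)
    rw [hX, form_zero_left] at h2
    have h3 := (mul_eq_zero.1 h2.symm).resolve_left ha
    fin_cases j <;> simpa [e, Matrix.vecMul, dotProduct, Fin.sum_univ_two] using h3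
  have h2 := Matrix.eq_zero_of_vecMul_eq_zero (h.det_ne_zero x hx) h1
  ext i
  exact congrFun h2 i

/-- For `a ≠ 0` the vectors `∂ₙ φ` span the tangent plane, on which the scalar product is definite.
-/
lemma eq_zero_of_form_eq_zero (h : IsHomothetic c a G φ U) (ha : a ≠ 0) (hx : x ∈ U) {w : R3}
    (hw : IsTangent c (φ x) w) (h0 : ∀ n, form c w (fderiv ℝ φ x (e n)) = 0) : w = 0 := by
  obtain ⟨X, rfl⟩ := exists_eq_of_isTangent (h.mem x hx) _ (h.injective ha hx) (h.isTangent hx) hw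
  refine hw.eq_zero (h.mem x hx) ?_
  conv_lhs => arg 3; rw [eq_sum_e X]
  rw [map_add, map_smul, map_smul, form_add_right, form_smul_right, form_smul_right, h0, h0]
  ring

/-- Smoothness of `G` is not part of `IsHomothetic`; it is recovered from `φ` on division by `a`. -/
lemma contDiffAt_metric (h : IsHomothetic c a G φ U) (ha : a ≠ 0) (hx : x ∈ U) (i j : Fin 2) :
    ContDiffAt ℝ ∞ (fun y => G y i j) x := by
  have h1 := ContDiffAt.form c (contDiffAt_fderiv_apply (h.smooth x hx) (e i))
    (contDiffAt_fderiv_apply (h.smooth x hx) (e j))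
  refine (contDiffAt_const (c := a⁻¹)).mul h1 |>.congr_of_eventuallyEq ?_
  filter_upwards [h.eventually_mem hx] with y hy
  rw [h.metric y hy]
  field_simp

lemma mul_partialDeriv_metric (h : IsHomothetic c a G φ U) (ha : a ≠ 0) (hx : x ∈ U)
    (l i j : Fin 2) : a * partialDeriv l (fun y => G y i j) x =
      form c (secondDeriv φ l i x) (fderiv ℝ φ x (e j)) +
        form c (secondDeriv φ l j x) (fderiv ℝ φ x (e i)) := by
  have h2 := fderiv_form_apply c (h.differentiableAt_fderiv_apply hx (e i))
    (h.differentiableAt_fderiv_apply hx (e j)) (e l)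
  have h1 : (fun y => form c (fderiv ℝ φ y (e i)) (fderiv ℝ φ y (e j))) =ᶠ[nhds x]
      fun y => a * G y i j := by
    filter_upwards [h.eventually_mem hx] with y hy
    exact h.metric y hy i j
  rw [h1.fderiv_eq, fderiv_const_mul ((h.contDiffAt_metric ha hx i j).differentiableAt (by simp))]
    at h2
  rw [form_comm c (secondDeriv φ l j x)]
  exact h2

/-- Koszul's argument: in the alternating sum of the three derivatives of the metric, the symmetry
of second derivatives leaves a single term twice. -/
lemma sum_christoffel_mul (h : IsHomothetic c a G φ U) (ha : a ≠ 0) (hx : x ∈ U)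
    (i j n : Fin 2) : a * ∑ k, christoffel G i j k x * G x k n =
      form c (secondDeriv φ i j x) (fderiv ℝ φ x (e n)) := by
  have hinv : G x * (G x)⁻¹ = 1 := Matrix.mul_nonsing_inv _ (h.det_ne_zero x hx).isUnit
  have hn : ∀ l, G x 0 n * (G x)⁻¹ 0 l + G x 1 n * (G x)⁻¹ 1 l = if n = l then 1 else 0 := by
    intro l
    have := congrFun (congrFun hinv n) l
    rw [Matrix.mul_apply, Fin.sum_univ_two, Matrix.one_apply, h.symm ha hx n 0,
      h.symm ha hx n 1] at this
    exact this
  set Q : Fin 2 → ℝ := fun l => partialDeriv i (fun y => G y j l) x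
    + partialDeriv j (fun y => G y i l) x - partialDeriv l (fun y => G y i j) x with hQ
  have h1 : ∑ k, christoffel G i j k x * G x k n = 1 / 2 * Q n := by
    have : ∀ k, christoffel G i j k x = 1 / 2 * ∑ l, (G x)⁻¹ k l * Q l := fun k => rfl
    simp only [this, Fin.sum_univ_two]
    have h0 := hn 0
    have h1 := hn 1
    have : (if n = 0 then 1 else 0) * Q 0 + (if n = 1 then 1 else 0) * Q 1 = Q n := by
      fin_cases n <;> simp
    rw [← this, ← h0, ← h1]
    ring
  have e1 := h.mul_partialDeriv_metric ha hx i j n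
  have e2 := h.mul_partialDeriv_metric ha hx j i n
  have e3 := h.mul_partialDeriv_metric ha hx n i j
  rw [h.secondDeriv_comm hx j i] at e2
  rw [h.secondDeriv_comm hx n i, h.secondDeriv_comm hx n j] at e3
  rw [h1, hQ]
  linear_combination (e1 + e2 - e3) / 2

/-- The Gauss formula. -/
theorem gauss_formula (h : IsHomothetic c a G φ U) (ha : a ≠ 0) (hx : x ∈ U) (i j : Fin 2) :
    secondDeriv φ i j x = christoffel G i j 0 x • fderiv ℝ φ x (e 0) +
      christoffel G i j 1 x • fderiv ℝ φ x (e 1) - (c * a * G x i j) • φ x := by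
  -- The difference of the two sides is tangent, and its products with both `∂ₙ φ` vanish.
  have ht := (h.isTangent_secondDeriv hx i j).sub
    (((h.isTangent hx (e 0)).smul (christoffel G i j 0 x)).add
      ((h.isTangent hx (e 1)).smul (christoffel G i j 1 x)))
  have h0 := h.eq_zero_of_form_eq_zero ha hx ht (fun n => by
    have h1 := h.sum_christoffel_mul ha hx i j n
    have h2 := h.mul_form_fderiv hx (e n)
    rw [Fin.sum_univ_two] at h1
    simp only [form_sub_left, form_add_left, form_smul_left, h.metric x hx]
    linear_combination (a * G x i j) * h2 - h1)
  rw [sub_eq_zero] at h0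
  rw [← h0]
  abel

end IsHomothetic

/-! ### The Gaussian curvature of a homothetic immersion -/

section Christoffel

variable {G : R2 → Matrix (Fin 2) (Fin 2) ℝ} {x : R2}

lemma differentiableAt_inv_apply (hG : ∀ i j, DifferentiableAt ℝ (fun y => G y i j) x)
    (hdet : (G x).det ≠ 0) (i j : Fin 2) : DifferentiableAt ℝ (fun y => (G y)⁻¹ i j) x := by
  have hadj : DifferentiableAt ℝ (fun y => (G y).adjugate i j) x := by
    simp only [Matrix.adjugate_fin_two]
    fin_cases i <;> fin_cases j <;> simp only [Fin.zero_eta, Fin.mk_one, Matrix.of_apply,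
      Matrix.cons_val_zero, Matrix.cons_val_one]
    exacts [hG 1 1, (hG 0 1).neg, (hG 1 0).neg, hG 0 0]
  have hd : DifferentiableAt ℝ (fun y => (G y).det) x := by
    simp only [Matrix.det_fin_two]
    exact ((hG 0 0).mul (hG 1 1)).sub ((hG 0 1).mul (hG 1 0))
  have : (fun y => (G y)⁻¹ i j) = fun y => ((G y).det)⁻¹ * (G y).adjugate i j := by
    funext y
    simp [Matrix.inv_def]
  rw [this]
  exact (hd.inv hdet).mul hadj

lemma differentiableAt_christoffel (hG : ∀ i j, ContDiffAt ℝ ∞ (fun y => G y i j) x)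
    (hdet : (G x).det ≠ 0) (i j k : Fin 2) : DifferentiableAt ℝ (christoffel G i j k) x := by
  have hp : ∀ l m n, DifferentiableAt ℝ (partialDeriv l (fun y => G y m n)) x := fun l m n =>
    (contDiffAt_fderiv_apply (hG m n) (e l)).differentiableAt (by simp)
  have hi := differentiableAt_inv_apply (fun i j => (hG i j).differentiableAt (by simp)) hdet
  refine DifferentiableAt.const_mul (DifferentiableAt.fun_sum fun l _ => ?_) _
  exact (hi k l).mul (((hp i j l).add (hp j i l)).sub (hp l i j))

end Christoffel

namespace IsHomothetic

variable {c a : ℝ} {G : R2 → Matrix (Fin 2) (Fin 2) ℝ} {φ : R2 → R3} {U : Set R2} {x : R2}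

/-- This is the Gauss formula differentiated and paired with `∂ₙ φ`. The term with the derivative of
`G` multiplies `φ` and drops out; the derivative of `φ` itself leaves the extrinsic product of
metric coefficients. -/
lemma form_fderiv_secondDeriv (h : IsHomothetic c a G φ U) (ha : a ≠ 0) (hx : x ∈ U)
    (i j k n : Fin 2) :
    form c (fderiv ℝ (secondDeriv φ j k) x (e i)) (fderiv ℝ φ x (e n)) =
      a * ∑ l, (partialDeriv i (christoffel G j k l) x +
        ∑ m, christoffel G j k m x * christoffel G i m l x) * G x l n
        - c * a * G x j k * (a * G x i n) := by
  have hG := h.contDiffAt_metric ha hx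
  have hΓ := differentiableAt_christoffel hG (h.det_ne_zero x hx)
  have heq : secondDeriv φ j k =ᶠ[nhds x] fun y => christoffel G j k 0 y • fderiv ℝ φ y (e 0) +
      christoffel G j k 1 y • fderiv ℝ φ y (e 1) - (c * a * G y j k) • φ y := by
    filter_upwards [h.eventually_mem hx] with y hy
    exact h.gauss_formula ha hy j k
  have hT := fun l => ((hΓ j k l).hasFDerivAt.smul
    (h.differentiableAt_fderiv_apply hx (e l)).hasFDerivAt)
  have hN := (((hG j k).differentiableAt (by simp)).hasFDerivAt.const_mul (c * a)).smul
    (h.differentiableAt hx).hasFDerivAt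
  have hall := ((hT 0).add (hT 1)).sub hN
  have hval := heq.fderiv_eq.trans hall.fderiv
  have happ := congrArg (fun L => L (e i)) hval
  simp only [add_apply, sub_apply, smul_apply,
    ContinuousLinearMap.smulRight_apply] at happ
  rw [happ]
  have hφ := h.mul_form_fderiv hx (e n)
  have hs := fun l => h.sum_christoffel_mul ha hx i l n
  simp only [Fin.sum_univ_two] at hs ⊢
  simp only [form_sub_left, form_add_left, form_smul_left, h.metric x hx, partialDeriv]
  change _ * form c (secondDeriv φ i 0 x) _ + _ + (_ * form c (secondDeriv φ i 1 x) _ + _) - _ = _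
  rw [← hs 0, ← hs 1]
  simp only [smul_eq_mul]
  linear_combination (-(a * fderiv ℝ (fun y => G y j k) x (e i))) * hφ

/-- A metric `G` for which `a G` is induced from `M²(c)` has curvature `c a`. -/
theorem curvature_eq (h : IsHomothetic c a G φ U) (ha : a ≠ 0) (hx : x ∈ U) :
    curvatureOfMetric G x = c * a := by
  have hφ1 : ContDiffAt ℝ ∞ (fun y => fderiv ℝ φ y (e 1)) x :=
    contDiffAt_fderiv_apply (h.smooth x hx) (e 1)
  -- Equality of the mixed third derivatives is the Gauss equation: subtracting the two expansions
  -- below gives `a ∑ R G = c a² det G`.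
  have hcomm : fderiv ℝ (secondDeriv φ 1 1) x (e 0) = fderiv ℝ (secondDeriv φ 0 1) x (e 1) :=
    fderiv_fderiv_apply_comm hφ1 (e 1) (e 0)
  have h0 := h.form_fderiv_secondDeriv ha hx 0 1 1 0
  have h1 := h.form_fderiv_secondDeriv ha hx 1 0 1 0
  rw [hcomm, h1] at h0
  have hdet := h.det_ne_zero x hx
  rw [curvatureOfMetric, div_eq_iff hdet, Matrix.det_fin_two]
  apply mul_left_cancel₀ ha
  simp only [riemann, Fin.sum_univ_two] at h0 ⊢
  rw [h.symm ha hx 1 0] at *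
  linear_combination -h0

end IsHomothetic

/-! ### Rigidity -/

/-- The linear map sending the standard basis to `φ, ∂₀ φ, ∂₁ φ`. -/
def frame (φ : R2 → R3) (x : R2) : R3 →L[ℝ] R3 :=
  ContinuousLinearMap.smulRightL ℝ R3 R3 (ContinuousLinearMap.proj 0) (φ x) +
    ContinuousLinearMap.smulRightL ℝ R3 R3 (ContinuousLinearMap.proj 1) (fderiv ℝ φ x (e 0)) +
    ContinuousLinearMap.smulRightL ℝ R3 R3 (ContinuousLinearMap.proj 2) (fderiv ℝ φ x (e 1))

lemma frame_apply (φ : R2 → R3) (x : R2) (t : R3) :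
    frame φ x t = t 0 • φ x + t 1 • fderiv ℝ φ x (e 0) + t 2 • fderiv ℝ φ x (e 1) := by
  simp [frame]

/-- The matrix `M` of the equation `∂ₖ A = A M` of the frame `A` of a homothetic immersion. -/
def frameMatrix (K : ℝ) (G : R2 → Matrix (Fin 2) (Fin 2) ℝ) (k : Fin 2) (x : R2) :
    Matrix (Fin 3) (Fin 3) ℝ :=
  !![0, -(K * G x k 0), -(K * G x k 1);
    if k = 0 then 1 else 0, christoffel G k 0 0 x, christoffel G k 1 0 x;
    if k = 1 then 1 else 0, christoffel G k 0 1 x, christoffel G k 1 1 x]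

namespace IsHomothetic

variable {c a : ℝ} {G : R2 → Matrix (Fin 2) (Fin 2) ℝ} {φ : R2 → R3} {U : Set R2} {x : R2}

lemma differentiableAt_frame (h : IsHomothetic c a G φ U) (hx : x ∈ U) :
    DifferentiableAt ℝ (frame φ) x := by
  have hL := fun i : Fin 3 => (ContinuousLinearMap.smulRightL ℝ R3 R3
    (ContinuousLinearMap.proj i)).differentiable
  have h0 := (hL 0 (φ x)).comp x (h.differentiableAt hx)
  have h1 := (hL 1 _).comp x (h.differentiableAt_fderiv_apply hx (e 0))
  have h2 := (hL 2 _).comp x (h.differentiableAt_fderiv_apply hx (e 1))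
  exact (h0.add h1).add h2

/-- This is the Gauss formula in matrix form. The coefficients see `c` and `a` only through the
product `c a`, which lets two different targets share one system. -/
lemma fderiv_frame_apply (h : IsHomothetic c a G φ U) (ha : a ≠ 0) (hx : x ∈ U) (k : Fin 2)
    (t : R3) : fderiv ℝ (frame φ) x (e k) t =
      frame φ x (frameMatrix (c * a) G k x *ᵥ t) := by
  have hA : HasFDerivAt (fun y => frame φ y t) ((fderiv ℝ (frame φ) x).flip t) x := by
    have := (h.differentiableAt_frame hx).hasFDerivAt.clm_apply (hasFDerivAt_const t x)
    simpa using this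
  have hB := (((h.differentiableAt hx).hasFDerivAt.const_smul (t 0)).add
      ((h.differentiableAt_fderiv_apply hx (e 0)).hasFDerivAt.const_smul (t 1))).add
      ((h.differentiableAt_fderiv_apply hx (e 1)).hasFDerivAt.const_smul (t 2))
  simp only [frame_apply] at hA
  have h1 := congrArg (fun L => L (e k)) (hA.unique hB)
  simp only [ContinuousLinearMap.flip_apply] at h1
  rw [h1]
  change t 0 • fderiv ℝ φ x (e k) + t 1 • secondDeriv φ k 0 x + t 2 • secondDeriv φ k 1 x = _
  rw [h.gauss_formula ha hx, h.gauss_formula ha hx, frame_apply]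
  simp only [frameMatrix, Matrix.mulVec, dotProduct, Fin.sum_univ_three, Matrix.of_apply,
    Matrix.cons_val_zero, Matrix.cons_val_one, Matrix.cons_val]
  fin_cases k <;> simp <;> module

/-- Since `c ≠ 0`, the position vector is normal and completes the tangent basis. -/
lemma isUnit_frame (h : IsHomothetic c a G φ U) (hc : c ≠ 0) (ha : a ≠ 0) (hx : x ∈ U) :
    IsUnit (frame φ x) := by
  have hinj : Function.Injective (frame φ x) := by
    rw [injective_iff_map_eq_zero]
    intro t ht
    rw [frame_apply] at ht
    have h1 := (injective_iff_map_eq_zero _).1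
      (injective_add_smul_normalVec (h.mem x hx) _ (h.injective ha hx) (h.isTangent hx))
      (t 1 • e 0 + t 2 • e 1, t 0)
      (by rw [← ht]; simp [normalVec_eq_self hc]; abel)
    rw [Prod.mk_eq_zero] at h1
    have h2 := congrArg (fun X : R2 => X 0) h1.1
    have h3 := congrArg (fun X : R2 => X 1) h1.1
    ext i
    fin_cases i
    · exact h1.2
    · simpa [e] using h2
    · simpa [e] using h3
  have he : frame φ x = ((LinearEquiv.ofInjectiveEndo (frame φ x : R3 →ₗ[ℝ] R3)
      hinj).toContinuousLinearEquiv : R3 →L[ℝ] R3) := by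
    ext; rfl
  rw [he]
  exact (ContinuousLinearEquiv.toUnit _).isUnit

/-- Here `f` and `g` stand for the two frames, `b` for the inverse of `f` and `b'` for its
derivative, `m` for the matrix of the system. The conclusion is that the product rule for `g b`
gives zero. -/
lemma _root_.mul_add_mul_mul_eq_zero {A : Type*} [Ring A] {f g b b' m : A}
    (h : m + b' * f = 0) (hb : f * b = 1) : g * b' + g * m * b = 0 := by
  have : b' = -(m * b) := by
    rw [← mul_one b', ← hb, ← mul_assoc, eq_neg_of_add_eq_zero_right h, neg_mul]
  rw [this, mul_neg, mul_assoc, neg_add_cancel]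

/-- Two homothetic immersions with the same metric and the same curvature of the target, up to
scaling, differ by a linear map. -/
theorem exists_linear (c₁ c₂ a₁ a₂ : ℝ) {φ₁ φ₂ : R2 → R3} (h₁ : IsHomothetic c₁ a₁ G φ₁ U)
    (h₂ : IsHomothetic c₂ a₂ G φ₂ U) (hc : 0 < c₁ * c₂) (ha₁ : a₁ ≠ 0) (ha₂ : a₂ ≠ 0)
    (hca : c₁ * a₁ = c₂ * a₂) (hx : x ∈ U) :
    ∃ C : R3 →L[ℝ] R3, (∀ v w, form c₂ (C v) (C w) = c₁ / c₂ * form c₁ v w) ∧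
      ∀ᶠ y in nhds x, φ₂ y = C (φ₁ y) := by
  have hc₁ : c₁ ≠ 0 := fun h => by simp [h] at hc
  have hc₂ : c₂ ≠ 0 := fun h => by simp [h] at hc
  obtain ⟨r, hr, hball⟩ := Metric.isOpen_iff.1 h₁.isOpen x hx
  set B : R2 → (R3 →L[ℝ] R3) := fun y => Ring.inverse (frame φ₁ y) with hB
  have hB1 : ∀ y ∈ U, frame φ₁ y * B y = 1 := fun y hy =>
    Ring.mul_inverse_cancel _ (h₁.isUnit_frame hc₁ ha₁ hy)
  have hB2 : ∀ y ∈ U, B y * frame φ₁ y = 1 := fun y hy =>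
    Ring.inverse_mul_cancel _ (h₁.isUnit_frame hc₁ ha₁ hy)
  have hBd : ∀ y ∈ U, DifferentiableAt ℝ B y := fun y hy => by
    obtain ⟨u, hu⟩ := h₁.isUnit_frame hc₁ ha₁ hy
    have := differentiableAt_inverse (𝕜 := ℝ) u.isUnit
    rw [hu] at this
    exact this.comp y (h₁.differentiableAt_frame hy)
  have hzero : ∀ y ∈ U, fderiv ℝ (fun z => frame φ₂ z * B z) y = 0 := by
    intro y hy
    have hk : ∀ k, fderiv ℝ (fun z => frame φ₂ z * B z) y (e k) = 0 := by
      intro k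
      have hd1 := ((hBd y hy).hasFDerivAt.mul' (h₁.differentiableAt_frame hy).hasFDerivAt)
      have hc1 : (fun z => B z * frame φ₁ z) =ᶠ[nhds y] fun _ => 1 := by
        filter_upwards [h₁.eventually_mem hy] with z hz
        exact hB2 z hz
      have e1 := congrArg (fun L => L (e k)) (hd1.fderiv.symm.trans hc1.fderiv_eq)
      have hd2 := ((h₂.differentiableAt_frame hy).hasFDerivAt.mul' (hBd y hy).hasFDerivAt)
      rw [show (fun z => frame φ₂ z * B z) = frame φ₂ * B from rfl, hd2.fderiv]
      simp only [fderiv_fun_const, Pi.zero_apply, zero_apply, add_apply,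
        smul_apply, smul_eq_mul,
        MulOpposite.smul_eq_mul_unop, MulOpposite.unop_op] at e1 ⊢
      set M : R3 →L[ℝ] R3 :=
        (Matrix.toLin' (frameMatrix (c₁ * a₁) G k y)).toContinuousLinearMap
      have m1 : fderiv ℝ (frame φ₁) y (e k) = frame φ₁ y * M := by
        ext1 t
        rw [h₁.fderiv_frame_apply ha₁ hy]
        rfl
      have m2 : fderiv ℝ (frame φ₂) y (e k) = frame φ₂ y * M := by
        ext1 t
        rw [h₂.fderiv_frame_apply ha₂ hy, ← hca]
        rfl
      rw [m1, ← mul_assoc, hB2 y hy, one_mul] at e1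
      rw [m2]
      exact mul_add_mul_mul_eq_zero e1 (hB1 y hy)
    ext1 X
    rw [eq_sum_e X, map_add, map_smul, map_smul, hk, hk]
    simp
  -- The constant value of `A₂ A₁⁻¹` on the ball is the linear map sought.
  have hconst : ∀ y ∈ Metric.ball x r, frame φ₂ y * B y = frame φ₂ x * B x := by
    intro y hy
    refine (convex_ball x r).is_const_of_fderivWithin_eq_zero (𝕜 := ℝ)
      (f := fun z => frame φ₂ z * B z) (fun z hz => ?_) (fun z hz => ?_) hy
      (Metric.mem_ball_self hr)
    · exact ((h₂.differentiableAt_frame (hball hz)).mul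
        (hBd z (hball hz))).differentiableWithinAt
    · rw [fderivWithin_of_isOpen Metric.isOpen_ball hz]
      exact hzero z (hball hz)
  have hC : ∀ y ∈ Metric.ball x r, ∀ t, (frame φ₂ x * B x) (frame φ₁ y t) = frame φ₂ y t := by
    intro y hy t
    rw [← hconst y hy, ← mul_apply_eq_comp, mul_assoc, hB2 y (hball hy), mul_one]
  refine ⟨frame φ₂ x * B x, fun v w => ?_, ?_⟩
  -- The scaling is checked in the basis formed by the frame at `x`: both `⟨φ, φ⟩ = 1 / c` and the
  -- tangential part `a G` change by the factor `c₁ / c₂`, the latter because `c₁ a₁ = c₂ a₂`.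
  · have hs : ∀ v, frame φ₁ x (B x v) = v := fun v => by
      rw [← mul_apply_eq_comp, hB1 x hx]; rfl
    have hself := hC x (Metric.mem_ball_self hr)
    rw [← hs v, ← hs w, hself, hself]
    have ht : ∀ {c a : ℝ} {φ : R2 → R3}, c ≠ 0 → IsHomothetic c a G φ U → ∀ X,
        form c (φ x) (fderiv ℝ φ x X) = 0 := fun hc h X => by
      simpa [IsTangent, normalVec_eq_self hc] using h.isTangent hx X
    have t1 := ht hc₁ h₁
    have t2 := ht hc₂ h₂
    have t1' := fun X => (form_comm _ _ _).trans (t1 X)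
    have t2' := fun X => (form_comm _ _ _).trans (t2 X)
    simp only [frame_apply, form_add_left, form_add_right, form_smul_left, form_smul_right,
      t1, t2, t1', t2', h₁.metric x hx, h₂.metric x hx, form_self_of_mem hc₁ (h₁.mem x hx),
      form_self_of_mem hc₂ (h₂.mem x hx)]
    have ha : a₂ = c₁ / c₂ * a₁ := by field_simp; linarith
    rw [ha]
    field_simp
    ring
  · filter_upwards [Metric.ball_mem_nhds x hr] with y hy
    -- The frame sends the first basis vector to the position vector.
    have := hC y hy ![1, 0, 0]
    simpa [frame_apply] using this.symm

end IsHomothetic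

/-! ### Factor zero, and covariant derivatives of homothetic maps -/

namespace IsHomothetic

variable {c a : ℝ} {G : R2 → Matrix (Fin 2) (Fin 2) ℝ} {φ : R2 → R3} {U : Set R2} {x : R2}

lemma fderiv_eq_zero (h : IsHomothetic c 0 G φ U) (hx : x ∈ U) : fderiv ℝ φ x = 0 := by
  ext1 X
  refine (h.isTangent hx X).eq_zero (h.mem x hx) ?_
  rw [h.form_fderiv hx, zero_mul]

end IsHomothetic

/-- The vector `∇_X Y` for constant vector fields `X, Y` and the metric `G`. -/
def christoffelVec (G : R2 → Matrix (Fin 2) (Fin 2) ℝ) (x X Y : R2) : R2 :=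
  ∑ i, ∑ j, (X i * Y j) • (christoffel G i j 0 x • e 0 + christoffel G i j 1 x • e 1)

lemma tangentProj_sub_smul (c s : ℝ) {p v : R3} (hp : p ∈ spaceForm c) (hv : IsTangent c p v) :
    tangentProj c p (v - (c * s) • p) = v := by
  by_cases hc : c = 0
  · simp [hc] at *
    exact tangentProj_of_isTangent hv
  · have h := form_self_of_mem hc hp
    rw [IsTangent, normalVec_eq_self hc] at hv
    rw [tangentProj, normalVec_eq_self hc, form_sub_right, form_smul_right, hv, h]
    have : (0 - c * s * (1 / c)) / (1 / c) = -(c * s) := by field_simp; simp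
    rw [this]
    module

/-- The Levi-Civita connection does not change when the metric is scaled by a constant, so the same
`christoffelVec G` serves every factor `a`. For `a = 0` both sides vanish. -/
lemma IsHomothetic.tangentProj_fderiv_fderiv {c a : ℝ} {G : R2 → Matrix (Fin 2) (Fin 2) ℝ}
    {φ : R2 → R3} {U : Set R2} {x : R2} (h : IsHomothetic c a G φ U) (hx : x ∈ U) (X Y : R2) :
    tangentProj c (φ x) (fderiv ℝ (fun y => fderiv ℝ φ y Y) x X) =
      fderiv ℝ φ x (christoffelVec G x X Y) := by
  by_cases ha : a = 0
  · subst ha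
    have : (fun y => fderiv ℝ φ y Y) =ᶠ[nhds x] fun _ => 0 := by
      filter_upwards [h.eventually_mem hx] with y hy
      rw [h.fderiv_eq_zero hy, zero_apply]
    rw [this.fderiv_eq, h.fderiv_eq_zero hx]
    simp [tangentProj, form_zero_right]
  · have h1 : fderiv ℝ (fun y => fderiv ℝ φ y Y) x X =
        ∑ i, ∑ j, (X i * Y j) • secondDeriv φ i j x := by
      have hd := (((h.differentiableAt_fderiv_apply hx (e 0)).hasFDerivAt.const_smul (Y 0)).add
        ((h.differentiableAt_fderiv_apply hx (e 1)).hasFDerivAt.const_smul (Y 1))).fderiv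
      have he : (fun y => fderiv ℝ φ y Y) =
          (Y 0 • fun y => fderiv ℝ φ y (e 0)) + Y 1 • fun y => fderiv ℝ φ y (e 1) := by
        funext y
        conv_lhs => rw [eq_sum_e Y, map_add, map_smul, map_smul]
        rfl
      rw [he, hd]
      conv_lhs => rw [eq_sum_e X]
      simp only [map_add, map_smul, add_apply, smul_apply, Fin.sum_univ_two]
      change X 0 • (Y 0 • secondDeriv φ 0 0 x + Y 1 • secondDeriv φ 0 1 x) +
        X 1 • (Y 0 • secondDeriv φ 1 0 x + Y 1 • secondDeriv φ 1 1 x) = _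
      module
    have h2 : fderiv ℝ (fun y => fderiv ℝ φ y Y) x X = fderiv ℝ φ x (christoffelVec G x X Y) -
        (c * (a * ∑ i, ∑ j, X i * Y j * G x i j)) • φ x := by
      rw [h1]
      simp only [h.gauss_formula ha hx, christoffelVec, Fin.sum_univ_two, map_add, map_smul]
      module
    rw [h2, tangentProj_sub_smul c _ (h.mem x hx) (h.isTangent hx _)]

/-! ### The induced metric -/

section Metric

variable {c₁ c₂ : ℝ} {P : Amb} {L : R2 →L[ℝ] Amb}

lemma prodMetric_comm (c₁ c₂ : ℝ) (v w : Amb) : prodMetric c₁ c₂ v w = prodMetric c₁ c₂ w v := by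
  rw [prodMetric, form_comm, form_comm c₂, prodMetric]

lemma prodMetric_add_left (c₁ c₂ : ℝ) (u v w : Amb) :
    prodMetric c₁ c₂ (u + v) w = prodMetric c₁ c₂ u w + prodMetric c₁ c₂ v w := by
  simp only [prodMetric, Prod.fst_add, Prod.snd_add, form_add_left]; ring

lemma prodMetric_smul_left (c₁ c₂ r : ℝ) (v w : Amb) :
    prodMetric c₁ c₂ (r • v) w = r * prodMetric c₁ c₂ v w := by
  simp only [prodMetric, Prod.smul_fst, Prod.smul_snd, form_smul_left]; ring

lemma prodMetric_add_right (c₁ c₂ : ℝ) (u v w : Amb) :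
    prodMetric c₁ c₂ u (v + w) = prodMetric c₁ c₂ u v + prodMetric c₁ c₂ u w := by
  simp only [prodMetric_comm c₁ c₂ u, prodMetric_add_left]

lemma prodMetric_smul_right (c₁ c₂ r : ℝ) (v w : Amb) :
    prodMetric c₁ c₂ v (r • w) = r * prodMetric c₁ c₂ v w := by
  simp only [prodMetric_comm c₁ c₂ v, prodMetric_smul_left]

/-- The Gram matrix of the metric induced by an injective linear map of the plane to a tangent
space of the product is invertible. -/
lemma det_of_prodMetric_ne_zero (hP : P ∈ productForm c₁ c₂) (hL : Function.Injective L)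
    (h₁ : ∀ X, IsTangent c₁ P.1 (L X).1) (h₂ : ∀ X, IsTangent c₂ P.2 (L X).2) :
    (Matrix.of fun i j => prodMetric c₁ c₂ (L (e i)) (L (e j))).det ≠ 0 := by
  intro hdet
  obtain ⟨v, hv, hv0⟩ := Matrix.exists_mulVec_eq_zero_iff.2 hdet
  apply hv
  have h0 := congrFun hv0 0
  have h1 := congrFun hv0 1
  simp only [Matrix.mulVec, dotProduct, Fin.sum_univ_two, Matrix.of_apply, Pi.zero_apply] at h0 h1
  have hq : prodMetric c₁ c₂ (L (v 0 • e 0 + v 1 • e 1)) (L (v 0 • e 0 + v 1 • e 1)) = 0 := by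
    simp only [map_add, map_smul, prodMetric_add_left, prodMetric_add_right,
      prodMetric_smul_left, prodMetric_smul_right]
    linear_combination v 0 * h0 + v 1 * h1
  set Z : R2 := v 0 • e 0 + v 1 • e 1 with hZ
  have n1 := (h₁ Z).form_self_nonneg hP.1
  have n2 := (h₂ Z).form_self_nonneg hP.2
  rw [prodMetric] at hq
  have z1 := (h₁ Z).eq_zero hP.1 (by linarith)
  have z2 := (h₂ Z).eq_zero hP.2 (by linarith)
  have hz : Z = 0 := (injective_iff_map_eq_zero L).1 hL Z (Prod.ext z1 z2)
  ext i
  have := congrArg (fun X : R2 => X i) hz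
  fin_cases i <;> simpa [hZ, e] using this

end Metric

/-! ### Immersed surfaces in charts -/

section Surface

variable {M : Type*} [TopologicalSpace M] [ChartedSpace R2 M] {c₁ c₂ : ℝ} {ψ : M → Amb}

lemma contDiffAt_localRep [IsManifold (𝓡 2) ∞ M] (h : IsImmersedSurface c₁ c₂ ψ) (p : M) {x : R2}
    (hx : x ∈ (extChartAt (𝓡 2) p).target) : ContDiffAt ℝ ∞ (localRep ψ p) x := by
  have h1 : ContMDiffOn 𝓘(ℝ, R2) 𝓘(ℝ, Amb) ∞ (localRep ψ p) (extChartAt (𝓡 2) p).target :=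
    h.smooth.comp_contMDiffOn (contMDiffOn_extChartAt_symm p)
  exact h1.contDiffOn.contDiffAt ((isOpen_extChartAt_target p).mem_nhds hx)

/-- `A` is the derivative of the inverse chart. It transfers what is known about `dpsi` at each
point of `M` to every point of a single chart. -/
lemma exists_fderiv_localRep [IsManifold (𝓡 2) ∞ M] (h : IsImmersedSurface c₁ c₂ ψ) (p : M)
    {x : R2} (hx : x ∈ (extChartAt (𝓡 2) p).target) :
    ∃ A : R2 →L[ℝ] R2, Function.Injective A ∧
      ∀ X, fderiv ℝ (localRep ψ p) x X = dpsi ψ ((extChartAt (𝓡 2) p).symm x) (A X) := by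
  have : IsManifold (𝓡 2) 1 M := IsManifold.of_le (n := ∞) (by norm_cast)
  have hm := mdifferentiableWithinAt_extChartAt_symm (I := 𝓡 2) hx
  have hi := isInvertible_mfderivWithin_extChartAt_symm (I := 𝓡 2) hx
  rw [modelWithCornersSelf_coe, Set.range_id] at hm hi
  rw [mdifferentiableWithinAt_univ] at hm
  rw [mfderivWithin_univ] at hi
  obtain ⟨A, hA⟩ := hi
  refine ⟨(show R2 ≃L[ℝ] R2 from A).toContinuousLinearMap, A.injective, fun X => ?_⟩
  have h1 := mfderiv_comp_apply x (h.smooth.mdifferentiableAt (by simp)) hm X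
  rw [← hA] at h1
  exact (congrArg (fun B : R2 →L[ℝ] Amb => B X) mfderiv_eq_fderiv.symm).trans h1

lemma dpsi_eq_fderiv_localRep (h : IsImmersedSurface c₁ c₂ ψ) (p : M) :
    dpsi ψ p = fderiv ℝ (localRep ψ p) (extChartAt (𝓡 2) p p) := by
  rw [dpsi, (h.smooth.mdifferentiableAt (by simp)).mfderiv]
  simp only [modelWithCornersSelf_coe, Set.range_id, fderivWithin_univ]
  rfl

lemma localRep_extChartAt (ψ : M → Amb) (p : M) :
    localRep ψ p (extChartAt (𝓡 2) p p) = ψ p := by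
  simp [localRep]

section Components

variable {φ : R2 → Amb} {x : R2}

lemma fderiv_fst_apply (h : DifferentiableAt ℝ φ x) (X : R2) :
    fderiv ℝ (fun y => (φ y).1) x X = (fderiv ℝ φ x X).1 := by
  rw [fderiv.fst h]; rfl

lemma fderiv_snd_apply (h : DifferentiableAt ℝ φ x) (X : R2) :
    fderiv ℝ (fun y => (φ y).2) x X = (fderiv ℝ φ x X).2 := by
  rw [fderiv.snd h]; rfl

end Components

lemma isTangent_localRep [IsManifold (𝓡 2) ∞ M] (h : IsImmersedSurface c₁ c₂ ψ) (p : M)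
    {x : R2} (hx : x ∈ (extChartAt (𝓡 2) p).target) (X : R2) :
    IsTangent c₁ (localRep ψ p x).1 (fderiv ℝ (localRep ψ p) x X).1 ∧
      IsTangent c₂ (localRep ψ p x).2 (fderiv ℝ (localRep ψ p) x X).2 := by
  have hd : DifferentiableAt ℝ (localRep ψ p) x :=
    (contDiffAt_localRep h p hx).differentiableAt (by simp)
  rw [← fderiv_fst_apply hd, ← fderiv_snd_apply hd]
  exact ⟨isTangent_fderiv (Filter.Eventually.of_forall fun y => (h.mem _).1) hd.fst X,
    isTangent_fderiv (Filter.Eventually.of_forall fun y => (h.mem _).2) hd.snd X⟩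

lemma isTangent_dpsi [IsManifold (𝓡 2) ∞ M] (h : IsImmersedSurface c₁ c₂ ψ) (p : M) (X : R2) :
    IsTangent c₁ (ψ p).1 (dpsi ψ p X).1 ∧ IsTangent c₂ (ψ p).2 (dpsi ψ p X).2 := by
  rw [dpsi_eq_fderiv_localRep h, ← localRep_extChartAt ψ p]
  exact isTangent_localRep h p (mem_extChartAt_target p) X

lemma det_gram_ne_zero [IsManifold (𝓡 2) ∞ M] (h : IsImmersedSurface c₁ c₂ ψ) (p : M) :
    (gram c₁ c₂ ψ p).det ≠ 0 :=
  det_of_prodMetric_ne_zero (L := dpsi ψ p) (h.mem p) (h.immersion p) (fun X => (isTangent_dpsi h p X).1)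
    fun X => (isTangent_dpsi h p X).2

lemma det_metricInChart_ne_zero [IsManifold (𝓡 2) ∞ M] (h : IsImmersedSurface c₁ c₂ ψ) (p : M)
    {x : R2} (hx : x ∈ (extChartAt (𝓡 2) p).target) : (metricInChart c₁ c₂ ψ p x).det ≠ 0 := by
  obtain ⟨A, hA, hA'⟩ := exists_fderiv_localRep h p hx
  refine det_of_prodMetric_ne_zero (L := fderiv ℝ (localRep ψ p) x) (P := localRep ψ p x) (h.mem _) ?_
    (fun X => (isTangent_localRep h p hx X).1) fun X => (isTangent_localRep h p hx X).2
  intro X Y hXY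
  rw [hA', hA'] at hXY
  exact hA (h.immersion _ hXY)

lemma gram_mulVec (c₁ c₂ : ℝ) (ψ : M → Amb) (p : M) (X : R2) (j : Fin 2) :
    (gram c₁ c₂ ψ p *ᵥ (X : Fin 2 → ℝ)) j = prodMetric c₁ c₂ (dpsi ψ p X) (dpsi ψ p (e j)) := by
  conv_rhs => rw [eq_sum_e X]
  erw [map_add, map_smul, map_smul]
  rw [prodMetric_add_left, prodMetric_smul_left, prodMetric_smul_left]
  simp only [Matrix.mulVec, dotProduct, Fin.sum_univ_two, gram, Matrix.of_apply, inducedMetric]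
  rw [prodMetric_comm c₁ c₂ (dpsi ψ p (e j)), prodMetric_comm c₁ c₂ (dpsi ψ p (e j))]
  ring

lemma tangentPart_dpsi [IsManifold (𝓡 2) ∞ M] (h : IsImmersedSurface c₁ c₂ ψ) (p : M) (X : R2) :
    tangentPart c₁ c₂ ψ p (dpsi ψ p X) = X := by
  have h1 : (fun j => prodMetric c₁ c₂ (dpsi ψ p X) (dpsi ψ p (e j))) =
      gram c₁ c₂ ψ p *ᵥ (X : Fin 2 → ℝ) := by
    funext j
    rw [gram_mulVec]
  rw [tangentPart, h1, Matrix.mulVec_mulVec,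
    Matrix.nonsing_inv_mul _ (det_gram_ne_zero h p).isUnit, Matrix.one_mulVec]

lemma prodMetric_tangentPart [IsManifold (𝓡 2) ∞ M] (h : IsImmersedSurface c₁ c₂ ψ) (p : M)
    (W : Amb) (X : R2) : prodMetric c₁ c₂ (dpsi ψ p (tangentPart c₁ c₂ ψ p W)) (dpsi ψ p X) =
      prodMetric c₁ c₂ W (dpsi ψ p X) := by
  have h1 : ∀ j, prodMetric c₁ c₂ (dpsi ψ p (tangentPart c₁ c₂ ψ p W)) (dpsi ψ p (e j)) =
      prodMetric c₁ c₂ W (dpsi ψ p (e j)) := by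
    intro j
    have := gram_mulVec c₁ c₂ ψ p (tangentPart c₁ c₂ ψ p W) j
    rw [← this, tangentPart, Matrix.mulVec_mulVec,
      Matrix.mul_nonsing_inv _ (det_gram_ne_zero h p).isUnit, Matrix.one_mulVec]
  rw [eq_sum_e X]
  erw [map_add, map_smul, map_smul]
  simp only [prodMetric_add_right, prodMetric_smul_right, h1]

/-- The two factor products have sum `g` by definition and difference `λ g` by the hypothesis on
`f`. -/
lemma form_dpsi_of_tensorF_eq [IsManifold (𝓡 2) ∞ M] (h : IsImmersedSurface c₁ c₂ ψ) {lam : ℝ}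
    (hf : ∀ (p : M) (X : TangentSpace (𝓡 2) p), tensorF c₁ c₂ ψ p X = lam • X) (p : M)
    (X Y : R2) :
    form c₁ (dpsi ψ p X).1 (dpsi ψ p Y).1 =
      (1 + lam) / 2 * prodMetric c₁ c₂ (dpsi ψ p X) (dpsi ψ p Y) ∧
    form c₂ (dpsi ψ p X).2 (dpsi ψ p Y).2 =
      (1 - lam) / 2 * prodMetric c₁ c₂ (dpsi ψ p X) (dpsi ψ p Y) := by
  have h1 := prodMetric_tangentPart h p (prodStructure (dpsi ψ p X)) Y
  have h2 := hf p X
  change tangentPart c₁ c₂ ψ p (prodStructure (dpsi ψ p X)) = lam • X at h2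
  rw [h2] at h1
  erw [map_smul] at h1
  rw [prodMetric_smul_left] at h1
  simp only [prodStructure, prodMetric, form_neg_left] at h1 ⊢
  constructor <;> linarith

lemma isHomothetic_localRep [IsManifold (𝓡 2) ∞ M] (h : IsImmersedSurface c₁ c₂ ψ) {lam : ℝ}
    (hf : ∀ (p : M) (X : TangentSpace (𝓡 2) p), tensorF c₁ c₂ ψ p X = lam • X) (p : M) :
    IsHomothetic c₁ ((1 + lam) / 2) (metricInChart c₁ c₂ ψ p) (fun x => (localRep ψ p x).1)
      (extChartAt (𝓡 2) p).target ∧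
    IsHomothetic c₂ ((1 - lam) / 2) (metricInChart c₁ c₂ ψ p) (fun x => (localRep ψ p x).2)
      (extChartAt (𝓡 2) p).target := by
  have hd : ∀ x ∈ (extChartAt (𝓡 2) p).target, DifferentiableAt ℝ (localRep ψ p) x := fun x hx =>
    (contDiffAt_localRep h p hx).differentiableAt (by simp)
  constructor
  · refine ⟨isOpen_extChartAt_target p, fun x hx => (contDiffAt_localRep h p hx).fst,
      fun x hx => (h.mem _).1, fun x hx i j => ?_, fun x hx => det_metricInChart_ne_zero h p hx⟩
    obtain ⟨A, -, hA⟩ := exists_fderiv_localRep h p hx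
    rw [fderiv_fst_apply (hd x hx), fderiv_fst_apply (hd x hx), metricInChart, Matrix.of_apply,
      hA, hA]
    exact (form_dpsi_of_tensorF_eq h hf _ _ _).1
  · refine ⟨isOpen_extChartAt_target p, fun x hx => (contDiffAt_localRep h p hx).snd,
      fun x hx => (h.mem _).2, fun x hx i j => ?_, fun x hx => det_metricInChart_ne_zero h p hx⟩
    obtain ⟨A, -, hA⟩ := exists_fderiv_localRep h p hx
    rw [fderiv_snd_apply (hd x hx), fderiv_snd_apply (hd x hx), metricInChart, Matrix.of_apply,
      hA, hA]
    exact (form_dpsi_of_tensorF_eq h hf _ _ _).2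

theorem isTotallyGeodesic_of_tensorF_eq [IsManifold (𝓡 2) ∞ M] (h : IsImmersedSurface c₁ c₂ ψ)
    {lam : ℝ} (hf : ∀ (p : M) (X : TangentSpace (𝓡 2) p), tensorF c₁ c₂ ψ p X = lam • X) :
    IsTotallyGeodesic c₁ c₂ ψ := by
  intro p X Y
  obtain ⟨h₁, h₂⟩ := isHomothetic_localRep h hf p
  have hx := mem_extChartAt_target (I := 𝓡 2) p
  set x := extChartAt (𝓡 2) p p with hxdef
  have hd : ∀ᶠ y in nhds x, DifferentiableAt ℝ (localRep ψ p) y := by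
    filter_upwards [(isOpen_extChartAt_target p).mem_nhds hx] with y hy
    exact (contDiffAt_localRep h p hy).differentiableAt (by simp)
  have hd2 : DifferentiableAt ℝ (fun y => fderiv ℝ (localRep ψ p) y Y) x :=
    (contDiffAt_fderiv_apply (contDiffAt_localRep h p hx) Y).differentiableAt (by simp)
  have e1 := h₁.tangentProj_fderiv_fderiv hx X Y
  have e2 := h₂.tangentProj_fderiv_fderiv hx X Y
  have f1 : (fun y => fderiv ℝ (fun x => (localRep ψ p x).1) y Y) =ᶠ[nhds x]
      fun y => (fderiv ℝ (localRep ψ p) y Y).1 := by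
    filter_upwards [hd] with y hy
    exact fderiv_fst_apply hy Y
  have f2 : (fun y => fderiv ℝ (fun x => (localRep ψ p x).2) y Y) =ᶠ[nhds x]
      fun y => (fderiv ℝ (localRep ψ p) y Y).2 := by
    filter_upwards [hd] with y hy
    exact fderiv_snd_apply hy Y
  rw [f1.fderiv_eq, fderiv_fst_apply hd2, fderiv_fst_apply hd.self_of_nhds] at e1
  rw [f2.fderiv_eq, fderiv_snd_apply hd2, fderiv_snd_apply hd.self_of_nhds] at e2
  -- Both components carry the same vector `∇_X Y`, so together they form `dψ (∇_X Y)`, which has no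
  -- normal part.
  have e3 : prodTangentProj c₁ c₂ (ψ p)
      (fderiv ℝ (fun x => fderiv ℝ (localRep ψ p) x Y) x X) =
      dpsi ψ p (christoffelVec (metricInChart c₁ c₂ ψ p) x X Y) := by
    rw [dpsi_eq_fderiv_localRep h, ← localRep_extChartAt ψ p]
    exact Prod.ext e1 e2
  rw [secondFundForm, e3, normalPart, tangentPart_dpsi h, sub_self]

end Surface

/-! ### Open parts of slices -/

/-- Thickening `φ` along the normal line gives a map from `R2 × ℝ` to `R3` with invertible
derivative at `(x, 0)`, hence locally open. Near that point its value lies in `M²(c)` only for `t =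
0`. -/
lemma IsHomothetic.exists_isOpen_inter_subset_image {c a : ℝ}
    {G : R2 → Matrix (Fin 2) (Fin 2) ℝ} {φ : R2 → R3} {U : Set R2} {x : R2}
    (h : IsHomothetic c a G φ U) (ha : a ≠ 0) (hx : x ∈ U) {W : Set R2} (hW : W ∈ nhds x) :
    ∃ V, IsOpen V ∧ φ x ∈ V ∧ V ∩ spaceForm c ⊆ φ '' W := by
  have hφ : HasStrictFDerivAt φ (fderiv ℝ φ x) x := (h.smooth x hx).hasStrictFDerivAt (by simp)
  have hφ' : HasStrictFDerivAt (fun z : R2 × ℝ => φ z.1)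
      ((fderiv ℝ φ x).comp (ContinuousLinearMap.fst ℝ R2 ℝ)) (x, 0) :=
    HasStrictFDerivAt.comp (x, (0 : ℝ)) (f := Prod.fst) hφ hasStrictFDerivAt_fst
  obtain ⟨N, hN⟩ : ∃ N : R2 × ℝ →L[ℝ] R3,
      HasStrictFDerivAt (fun z : R2 × ℝ => normalVec c (φ z.1)) N (x, 0) := by
    by_cases hc : c = 0
    · simp only [normalVec, if_pos hc]
      exact ⟨_, hasStrictFDerivAt_const _ _⟩
    · simp only [normalVec, if_neg hc]
      exact ⟨_, hφ'⟩
  have hΞ : HasStrictFDerivAt (fun z : R2 × ℝ => φ z.1 + z.2 • normalVec c (φ z.1))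
      ((fderiv ℝ φ x).coprod (ContinuousLinearMap.toSpanSingleton ℝ (normalVec c (φ x))))
      (x, 0) := by
    have h1 := hφ'.add ((hasStrictFDerivAt_snd (𝕜 := ℝ) (p := (x, (0 : ℝ)))).smul hN)
    -- The derivative `N` of the normal field enters multiplied by `t = 0`.
    have h2 : (fderiv ℝ φ x).coprod (ContinuousLinearMap.toSpanSingleton ℝ (normalVec c (φ x))) =
        (fderiv ℝ φ x).comp (ContinuousLinearMap.fst ℝ R2 ℝ) + ((x, (0 : ℝ)).2 • N +
          (ContinuousLinearMap.snd ℝ R2 ℝ).smulRight (normalVec c (φ x))) := by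
      refine ContinuousLinearMap.ext fun z => ?_
      simp
    rw [h2]
    exact h1
  have hinj := injective_add_smul_normalVec (h.mem x hx) _ (h.injective ha hx) (h.isTangent hx)
  set A := LinearEquiv.ofInjectiveOfFinrankEq
    ((fderiv ℝ φ x).coprod (ContinuousLinearMap.toSpanSingleton ℝ (normalVec c (φ x)))).toLinearMap
    hinj finrank_R2_prod_real with hA
  have hΞ' : HasStrictFDerivAt (fun z : R2 × ℝ => φ z.1 + z.2 • normalVec c (φ z.1))
      (A.toContinuousLinearEquiv : R2 × ℝ →L[ℝ] R3) (x, 0) := hΞ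
  have hmap := hΞ'.map_nhds_eq_of_equiv
  -- For `c ≠ 0` the condition `(1 + t)² = 1` also has the root `t = -2`, the antipode, which the
  -- bound on `t` excludes.
  have hS : (W ∩ U) ×ˢ Set.Ioo (-1 : ℝ) 1 ∈ nhds (x, (0 : ℝ)) :=
    prod_mem_nhds (Filter.inter_mem hW (h.isOpen.mem_nhds hx)) (Ioo_mem_nhds (by simp) (by simp))
  have hI := Filter.image_mem_map hS (m := fun z : R2 × ℝ => φ z.1 + z.2 • normalVec c (φ z.1))
  rw [hmap] at hI
  refine ⟨_, isOpen_interior, mem_interior_iff_mem_nhds.2 (by simpa using hI), ?_⟩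
  rintro v ⟨hv, hvc⟩
  obtain ⟨⟨y, t⟩, ⟨⟨hyW, hyU⟩, ht1, ht2⟩, rfl⟩ := interior_subset hv
  simp only at ht1 ht2 hvc ⊢
  suffices ht : t = 0 from ⟨y, hyW, by simp [ht]⟩
  have hy := h.mem y hyU
  by_cases hc : c = 0
  · subst hc
    rw [mem_spaceForm_zero] at hy hvc
    simpa [normalVec, hy] using hvc
  · have e1 := form_self_of_mem hc hy
    have e2 := form_self_of_mem hc hvc
    rw [normalVec_eq_self hc] at e2
    simp only [form_add_left, form_add_right, form_smul_left, form_smul_right, e1] at e2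
    field_simp at e2
    have : t * (t + 2) = 0 := by linarith
    exact (mul_eq_zero.1 this).resolve_right (by linarith)

section Surface

variable {M : Type*} [TopologicalSpace M] [ChartedSpace R2 M] {c₁ c₂ : ℝ} {ψ : M → Amb}

/-- A map is constant if its derivative vanishes in all charts. -/
lemma eq_of_fderiv_eq_zero [PreconnectedSpace M] {f : M → R3}
    (hf : ∀ p : M, ∀ x ∈ (extChartAt (𝓡 2) p).target,
      DifferentiableAt ℝ (fun y => f ((extChartAt (𝓡 2) p).symm y)) x ∧
        fderiv ℝ (fun y => f ((extChartAt (𝓡 2) p).symm y)) x = 0) (p q : M) : f p = f q := by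
  refine IsLocallyConstant.apply_eq_of_preconnectedSpace ?_ p q
  rw [IsLocallyConstant.iff_eventually_eq]
  intro p
  obtain ⟨r, hr, hball⟩ := Metric.isOpen_iff.1 (isOpen_extChartAt_target (I := 𝓡 2) p) _
    (mem_extChartAt_target p)
  filter_upwards [extChartAt_source_mem_nhds (I := 𝓡 2) p,
    (continuousAt_extChartAt (I := 𝓡 2) p).preimage_mem_nhds (Metric.ball_mem_nhds _ hr)]
    with q hq hqr
  have h1 := (convex_ball (extChartAt (𝓡 2) p p) r).is_const_of_fderivWithin_eq_zero (𝕜 := ℝ)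
    (f := fun y => f ((extChartAt (𝓡 2) p).symm y))
    (fun z hz => (hf p z (hball hz)).1.differentiableWithinAt)
    (fun z hz => by
      rw [fderivWithin_of_isOpen Metric.isOpen_ball hz]
      exact (hf p z (hball hz)).2) hqr (Metric.mem_ball_self hr)
  simp only [(extChartAt (𝓡 2) p).left_inv hq, extChartAt_to_inv] at h1
  exact h1

/-- A chart with given coordinate functions, by the inverse function theorem. -/
lemma exists_chart_of_injective_fderiv [IsManifold (𝓡 2) ∞ M] (p : M) {f : R2 → R2}
    (hf : ∀ᶠ y in nhds (extChartAt (𝓡 2) p p), ContDiffAt ℝ ∞ f y)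
    (hinj : Function.Injective (fderiv ℝ f (extChartAt (𝓡 2) p p))) {W : Set M}
    (hW : W ∈ nhds p) :
    ∃ χ ∈ IsManifold.maximalAtlas (𝓡 2) ∞ M, p ∈ χ.source ∧ χ.source ⊆ W ∧
      ∀ q ∈ χ.source, χ q = f (extChartAt (𝓡 2) p q) := by
  set x := extChartAt (𝓡 2) p p with hx
  have hfx := hf.self_of_nhds
  set A : R2 ≃L[ℝ] R2 :=
    (LinearEquiv.ofInjectiveEndo (fderiv ℝ f x).toLinearMap hinj).toContinuousLinearEquiv
  have hA : (A : R2 →L[ℝ] R2) = fderiv ℝ f x := by ext1; rfl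
  have hd : HasFDerivAt f (A : R2 →L[ℝ] R2) x := by
    rw [hA]; exact (hfx.differentiableAt (by simp)).hasFDerivAt
  -- Invertibility is an open condition. It is needed throughout the domain of the chart, since the
  -- inverse must be smooth at every point and not only at the image of `p`.
  have hinv : ∀ᶠ y in nhds x, fderiv ℝ f y ∈ Set.range ((↑) : (R2 ≃L[ℝ] R2) → R2 →L[ℝ] R2) :=
    (hfx.fderiv_right (m := 0) (by norm_cast)).continuousAt.eventually_mem
      (ContinuousLinearEquiv.isOpen.mem_nhds ⟨A, hA⟩)
  obtain ⟨O, hO, hOo, hxO⟩ := eventually_nhds_iff.1 (hf.and hinv)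
  set E := hfx.toOpenPartialHomeomorph f hd (by simp) with hE
  set E' := E.restrOpen O hOo with hE'
  set χ₀ := (chartAt R2 p).trans E' with hχ₀
  set χ := χ₀.restrOpen (interior W) isOpen_interior with hχ
  have hsrc : ∀ q ∈ χ.source, q ∈ (chartAt R2 p).source ∧ chartAt R2 p q ∈ E.source ∧
      chartAt R2 p q ∈ O ∧ q ∈ interior W := by
    intro q hq
    simp [hχ, hχ₀, hE'] at hq
    tauto
  have hχf : ∀ q, χ q = f (chartAt R2 p q) := fun q => rfl
  refine ⟨χ, ?_, ?_, fun q hq => interior_subset (hsrc q hq).2.2.2, fun q hq => ?_⟩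
  · have hchart := IsManifold.chart_mem_maximalAtlas (I := 𝓡 2) (n := ∞) p
    refine OpenPartialHomeomorph.mem_maximalAtlas_of_contMDiffOn χ ?_ ?_
    · intro q hq
      obtain ⟨h1, h2, h3, -⟩ := hsrc q hq
      have hc : ContMDiffAt (𝓡 2) (𝓡 2) ∞ (chartAt R2 p) q :=
        contMDiffAt_of_mem_maximalAtlas hchart h1
      exact (ContMDiffAt.comp q (hO _ h3).1.contMDiffAt hc).contMDiffWithinAt
    · intro y hy
      have hq := χ.map_target hy
      obtain ⟨h1, h2, h3, -⟩ := hsrc _ hq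
      have hyE : chartAt R2 p (χ.symm y) = E.symm y := by
        have : y ∈ χ₀.target := by
          have h5 := χ₀.map_source (x := χ.symm y) hq.1
          have h6 : χ₀ (χ.symm y) = y := χ.right_inv hy
          rwa [h6] at h5
        have hmem : E'.symm y ∈ (chartAt R2 p).target := by
          rw [hχ₀, OpenPartialHomeomorph.trans_target] at this
          exact this.2
        exact (chartAt R2 p).right_inv hmem
      have hyt : y ∈ E.target := by
        have h4 := E.map_source h2
        have h5 : E (chartAt R2 p (χ.symm y)) = y := χ.right_inv hy
        rwa [h5] at h4
      obtain ⟨B, hB⟩ := (hO _ h3).2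
      have hs : ContDiffAt ℝ ∞ E.symm y := by
        rw [hyE] at h3 hB
        refine E.contDiffAt_symm (f₀' := B) hyt ?_ (hO _ h3).1
        rw [hB]
        exact ((hO _ h3).1.differentiableAt (by simp)).hasFDerivAt
      have hc : ContMDiffAt (𝓡 2) (𝓡 2) ∞ (chartAt R2 p).symm (E.symm y) := by
        refine contMDiffAt_symm_of_mem_maximalAtlas hchart ?_
        rw [← hyE]
        exact (chartAt R2 p).map_source h1
      exact (ContMDiffAt.comp y hc hs.contMDiffAt).contMDiffWithinAt
  · have h1 : chartAt R2 p p ∈ E.source := hfx.mem_toOpenPartialHomeomorph_source hd (by simp)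
    have h2 : p ∈ interior W := mem_interior_iff_mem_nhds.2 hW
    have h3 : chartAt R2 p p ∈ O := hxO
    simp [hχ, hχ₀, hE', h1, h2, h3]
  · rw [hχf]; rfl

end Surface

/-! ### Isometries of space forms -/

lemma form_eq_form {c₁ c₂ : ℝ} (hc : 0 < c₁ * c₂) : form c₁ = form c₂ := by
  have : c₁ < 0 ↔ c₂ < 0 :=
    neg_iff_neg_of_mul_pos hc
  funext v w
  simp only [form, this]

/-- Reverse Cauchy–Schwarz: both vectors are timelike with positive first coordinate, so `p 0 * q 0`
dominates the spatial product. -/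
lemma form_neg_of_mem {c : ℝ} (hc : c < 0) {p q : R3} (hp : p ∈ spaceForm c)
    (hq : q ∈ spaceForm c) : form c p q < 0 := by
  have hp1 := form_self_of_mem hc.ne hp
  have hq1 := form_self_of_mem hc.ne hq
  have hp0 := apply_zero_pos_of_mem hc hp
  have hq0 := apply_zero_pos_of_mem hc hq
  have hk : 1 / c < 0 := one_div_neg.2 hc
  simp only [form, if_pos hc] at *
  have h1 : p 1 * p 1 + p 2 * p 2 < p 0 * p 0 := by linarith
  have h2 : q 1 * q 1 + q 2 * q 2 < q 0 * q 0 := by linarith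
  have h3 : (p 1 * q 1 + p 2 * q 2) ^ 2 < (p 0 * q 0) ^ 2 := by
    have h4 : (p 1 * p 1 + p 2 * p 2) * (q 1 * q 1 + q 2 * q 2) <
        (p 0 * p 0) * (q 0 * q 0) := mul_lt_mul'' h1 h2
          (add_nonneg (mul_self_nonneg _) (mul_self_nonneg _))
          (add_nonneg (mul_self_nonneg _) (mul_self_nonneg _))
    nlinarith [sq_nonneg (p 1 * q 2 - p 2 * q 1)]
  have h5 := lt_of_pow_lt_pow_left₀ 2 (mul_pos hp0 hq0).le h3
  linarith

/-- If `q` lay on the lower sheet, then `-q` would lie on the upper one and have a negative product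
with `p`. -/
lemma mem_spaceForm_of_form_neg {c : ℝ} (hc : c < 0) {p q : R3} (hp : p ∈ spaceForm c)
    (hq : form c q q = 1 / c) (hpq : form c p q < 0) : q ∈ spaceForm c := by
  simp only [spaceForm, Set.mem_ofPred_eq, if_neg hc.ne]
  refine ⟨hq, fun _ => ?_⟩
  by_contra! h0
  have hk : 1 / c < 0 := one_div_neg.2 hc
  have hne : q 0 ≠ 0 := by
    intro h
    simp only [form, if_pos hc, h] at hq
    nlinarith [mul_self_nonneg (q 1), mul_self_nonneg (q 2)]
  have hneg : -q ∈ spaceForm c := by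
    simp only [spaceForm, Set.mem_ofPred_eq, if_neg hc.ne]
    refine ⟨?_, fun _ => ?_⟩
    · rw [form_neg_left, form_comm, form_neg_left, hq, neg_neg]
    · simpa using lt_of_le_of_ne h0 hne
  have := form_neg_of_mem hc hp hneg
  rw [form_comm, form_neg_left, form_comm] at this
  linarith

lemma mem_spaceForm_of_pos {c : ℝ} (hc : 0 < c) {q : R3} (hq : form c q q = 1 / c) :
    q ∈ spaceForm c := by
  simp only [spaceForm, Set.mem_ofPred_eq, if_neg hc.ne']
  exact ⟨hq, fun h => absurd h hc.not_gt⟩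

/-- For `c < 0` a linear isometry might exchange the two sheets; a single point of the upper sheet
that stays there rules this out. -/
lemma map_mem_spaceForm {c : ℝ} (hc : c ≠ 0) (T : R3 →ₗ[ℝ] R3)
    (hT : ∀ v w, form c (T v) (T w) = form c v w) {p q : R3} (hp : p ∈ spaceForm c)
    (hTp : T p ∈ spaceForm c) (hq : q ∈ spaceForm c) : T q ∈ spaceForm c := by
  have h1 : form c (T q) (T q) = 1 / c := by rw [hT, form_self_of_mem hc hq]
  rcases lt_or_gt_of_ne hc with h | h
  · exact mem_spaceForm_of_form_neg h hTp h1 (by rw [hT]; exact form_neg_of_mem h hp hq)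
  · exact mem_spaceForm_of_pos h h1

lemma isSpaceFormIsometry_refl (c : ℝ) : IsSpaceFormIsometry c (AffineEquiv.refl ℝ R3) :=
  ⟨fun _ _ => rfl, by simp⟩

lemma isSpaceFormIsometry_symm {c : ℝ} (hc : c ≠ 0) (T : R3 ≃ₗ[ℝ] R3)
    (hT : ∀ v w, form c (T v) (T w) = form c v w) {p : R3} (hp : p ∈ spaceForm c)
    (hTp : T p ∈ spaceForm c) : IsSpaceFormIsometry c T.symm.toAffineEquiv := by
  have hT' : ∀ v w, form c (T.symm v) (T.symm w) = form c v w := fun v w => by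
    rw [← hT, T.apply_symm_apply, T.apply_symm_apply]
  refine ⟨hT', Set.Subset.antisymm ?_ fun q hq => ?_⟩
  · rintro _ ⟨q, hq, rfl⟩
    exact map_mem_spaceForm hc T.symm.toLinearMap hT' hTp (by simpa using hp) hq
  · exact ⟨T q, map_mem_spaceForm hc T.toLinearMap hT hp hTp hq, T.symm_apply_apply q⟩

lemma smul_mem_spaceForm {c₁ c₂ : ℝ} (hc : 0 < c₁ * c₂) {p : R3} (hp : p ∈ spaceForm c₁) :
    √(c₁ / c₂) • p ∈ spaceForm c₂ := by
  have hc₁ : c₁ ≠ 0 := fun h => by simp [h] at hc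
  have hc₂ : c₂ ≠ 0 := fun h => by simp [h] at hc
  have hr : 0 < c₁ / c₂ := div_pos_iff.2 (pos_and_pos_or_neg_and_neg_of_mul_pos hc)
  simp only [spaceForm, Set.mem_ofPred_eq, if_neg hc₂]
  constructor
  · rw [form_smul_left, form_smul_right, ← form_eq_form hc, form_self_of_mem hc₁ hp, ← mul_assoc,
      Real.mul_self_sqrt hr.le]
    field_simp
  · intro h
    have h1 : c₁ < 0 := (neg_iff_neg_of_mul_pos hc).2 h
    exact mul_pos (Real.sqrt_pos.2 hr) (apply_zero_pos_of_mem h1 hp)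

/-! ### Surfaces homothetic to both factors -/

section Surface

variable {M : Type*} [TopologicalSpace M] [ChartedSpace R2 M] [IsManifold (𝓡 2) ∞ M]
  {c₁ c₂ : ℝ} {ψ : M → Amb}

/-- A surface homothetic to both factors is, up to an isometry of the second factor, the graph of
a scaling; a parametrization `Ψ` of the first factor gives coordinates on the surface. -/
theorem exists_chart_eq_parametrization (h : IsImmersedSurface c₁ c₂ ψ) {lam : ℝ}
    (hf : ∀ (p : M) (X : TangentSpace (𝓡 2) p), tensorF c₁ c₂ ψ p X = lam • X)
    (hc : 0 < c₁ * c₂) (h₁ : (1 + lam) / 2 ≠ 0) (h₂ : (1 - lam) / 2 ≠ 0)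
    (hca : c₁ * ((1 + lam) / 2) = c₂ * ((1 - lam) / 2)) (p : M) {F : R3 → R2} {Ψ : R2 → R3}
    (hF : ∀ᶠ w in nhds (ψ p).1, ContDiffAt ℝ ∞ F w) (hΨ : Differentiable ℝ Ψ)
    (hΨF : ∀ᶠ w in nhds (ψ p).1, w ∈ spaceForm c₁ → Ψ (F w) = w) :
    ∃ χ ∈ IsManifold.maximalAtlas (𝓡 2) ∞ M, p ∈ χ.source ∧
      ∃ τ₁ τ₂ : R3 ≃ᵃ[ℝ] R3, IsSpaceFormIsometry c₁ τ₁ ∧ IsSpaceFormIsometry c₂ τ₂ ∧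
        ∀ q ∈ χ.source, (τ₁ (ψ q).1, τ₂ (ψ q).2) = (Ψ (χ q), √(c₁ / c₂) • Ψ (χ q)) := by
  have hc₂ : c₂ ≠ 0 := fun h => by simp [h] at hc
  have hr : 0 < c₁ / c₂ := div_pos_iff.2 (pos_and_pos_or_neg_and_neg_of_mul_pos hc)
  set r := √(c₁ / c₂) with hrdef
  have hr0 : r ≠ 0 := (Real.sqrt_pos.2 hr).ne'
  have hrr : r * r = c₁ / c₂ := Real.mul_self_sqrt hr.le
  obtain ⟨H₁, H₂⟩ := isHomothetic_localRep h hf p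
  have hx := mem_extChartAt_target (I := 𝓡 2) p
  set x := extChartAt (𝓡 2) p p with hxdef
  set φ₁ : R2 → R3 := fun x => (localRep ψ p x).1 with hφ₁
  obtain ⟨C, hC, hCeq⟩ := H₁.exists_linear _ _ _ _ H₂ hc h₁ h₂ hca hx
  have hφx : φ₁ x = (ψ p).1 := by rw [hφ₁, hxdef]; simp only [localRep_extChartAt]
  have hcont : ContinuousAt φ₁ x := (H₁.differentiableAt hx).continuousAt
  rw [← hφx] at hF hΨF
  have hf1 : ∀ᶠ y in nhds x, ContDiffAt ℝ ∞ (fun y => F (φ₁ y)) y := by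
    filter_upwards [hcont.eventually hF, H₁.eventually_mem hx] with y hy hyU
    exact ContDiffAt.comp y hy (H₁.smooth y hyU)
  have heq : ∀ᶠ y in nhds x, Ψ (F (φ₁ y)) = φ₁ y := by
    filter_upwards [hcont.eventually hΨF] with y hy
    exact hy (h.mem _).1
  -- Near `x` the immersion `φ₁` factors as `Ψ ∘ (F ∘ φ₁)`, so the derivative of the inner map is
  -- injective.
  have hinj : Function.Injective (fderiv ℝ (fun y => F (φ₁ y)) x) := by
    have h1 := H₁.injective h₁ hx
    have h2 : fderiv ℝ φ₁ x = (fderiv ℝ Ψ (F (φ₁ x))).comp (fderiv ℝ (fun y => F (φ₁ y)) x) := by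
      rw [← fderiv_comp x (hΨ _) (hf1.self_of_nhds.differentiableAt (by simp))]
      exact Filter.EventuallyEq.fderiv_eq (heq.mono fun y hy => hy.symm)
    rw [h2, ContinuousLinearMap.coe_comp] at h1
    exact h1.of_comp
  have hW : ∀ᶠ q in nhds p, (ψ q).2 = C (ψ q).1 ∧ Ψ (F (ψ q).1) = (ψ q).1 ∧
      q ∈ (extChartAt (𝓡 2) p).source := by
    filter_upwards [(continuousAt_extChartAt (I := 𝓡 2) p).eventually (hCeq.and heq),
      extChartAt_source_mem_nhds (I := 𝓡 2) p] with q hq hqs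
    simp only [hφ₁, localRep, Function.comp_apply, (extChartAt (𝓡 2) p).left_inv hqs] at hq
    exact ⟨hq.1, hq.2, hqs⟩
  obtain ⟨χ, hχ, hpχ, hsub, hχf⟩ := exists_chart_of_injective_fderiv p hf1 hinj hW
  -- `C` scales the scalar product by `c₁ / c₂ = r²`, so `r⁻¹ C` preserves it. Its inverse becomes
  -- the isometry `τ₂`, taking `φ₂ = C φ₁` to `r φ₁`.
  have hTform : ∀ v w, form c₂ ((r⁻¹ • C) v) ((r⁻¹ • C) w) = form c₂ v w := by
    intro v w
    rw [smul_apply, smul_apply, form_smul_left, form_smul_right, hC, ← hrr, form_eq_form hc]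
    field_simp
  have hTinj : Function.Injective (r⁻¹ • C) := by
    rw [injective_iff_map_eq_zero]
    intro v hv
    refine form_nondegenerate (c := c₂) fun w => ?_
    rw [← hTform, hv, form_zero_left]
  set T := LinearEquiv.ofInjectiveEndo (r⁻¹ • C).toLinearMap hTinj with hT
  have hTv : ∀ v, T v = r⁻¹ • C v := fun v => rfl
  have hTr : ∀ q ∈ χ.source, T (r • (ψ q).1) = (ψ q).2 := by
    intro q hq
    rw [hTv, map_smul, smul_smul, inv_mul_cancel₀ hr0, one_smul]
    exact (hsub hq).1.symm
  refine ⟨χ, hχ, hpχ, AffineEquiv.refl ℝ R3, T.symm.toAffineEquiv, isSpaceFormIsometry_refl c₁,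
    isSpaceFormIsometry_symm hc₂ T hTform (smul_mem_spaceForm hc (h.mem p).1)
      (by rw [← hrdef, hTr p hpχ]; exact (h.mem p).2), fun q hq => ?_⟩
  obtain ⟨-, h2, hqs⟩ := hsub hq
  have h3 : Ψ (χ q) = (ψ q).1 := by
    rw [hχf q hq]
    simp only [hφ₁, localRep, Function.comp_apply, (extChartAt (𝓡 2) p).left_inv hqs]
    exact h2
  rw [h3]
  refine Prod.ext rfl ?_
  change T.symm (ψ q).2 = r • (ψ q).1
  rw [← hTr q hq, T.symm_apply_apply]

end Surface

/-! ### Orthogonal frames -/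

/-- With the norm `|c|⁻¹`, that of `p` up to sign, the circle or hyperbola through `p` in this
direction stays in `M²(c)`. -/
lemma exists_tangent_of_form_eq {c : ℝ} {p v : R3} (hc : c ≠ 0) (hp : p ∈ spaceForm c)
    (hv : IsTangent c p v) (hv0 : v ≠ 0) :
    ∃ w, form c p w = 0 ∧ form c w w = |c|⁻¹ := by
  have h1 := hv.form_self_nonneg hp
  have h2 : form c v v ≠ 0 := fun h => hv0 (hv.eq_zero hp h)
  have h3 : 0 < |c|⁻¹ / form c v v := by positivity
  rw [IsTangent, normalVec_eq_self hc] at hv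
  refine ⟨√(|c|⁻¹ / form c v v) • v, by rw [form_smul_right, hv, mul_zero], ?_⟩
  rw [form_smul_left, form_smul_right, ← mul_assoc, Real.mul_self_sqrt h3.le,
    div_mul_cancel₀ _ h2]

/-- Expansion of a vector in an orthogonal frame. -/
lemma eq_sum_of_orthogonal {c : ℝ} {P Q N : R3} (hP : form c P P ≠ 0) (hQ : form c Q Q ≠ 0)
    (hN : form c N N ≠ 0) (hPQ : form c P Q = 0) (hPN : form c P N = 0) (hQN : form c Q N = 0)
    (w : R3) : w = (form c w P / form c P P) • P + (form c w Q / form c Q Q) • Q +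
      (form c w N / form c N N) • N := by
  set L : R3 →ₗ[ℝ] R3 := (LinearMap.proj 0).smulRight P + (LinearMap.proj 1).smulRight Q +
    (LinearMap.proj 2).smulRight N
  have hL : ∀ t, L t = t 0 • P + t 1 • Q + t 2 • N := fun t => rfl
  have hQP := (form_comm c Q P).trans hPQ
  have hNP := (form_comm c N P).trans hPN
  have hNQ := (form_comm c N Q).trans hQN
  have hcoef : ∀ t, form c (L t) P = t 0 * form c P P ∧ form c (L t) Q = t 1 * form c Q Q ∧
      form c (L t) N = t 2 * form c N N := by
    intro t
    simp [hL, form_add_left, form_smul_left, hPQ, hPN, hQN, hQP, hNP, hNQ]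
  have hinj : Function.Injective L := by
    rw [injective_iff_map_eq_zero]
    intro t ht
    obtain ⟨h0, h1, h2⟩ := hcoef t
    rw [ht, form_zero_left] at h0 h1 h2
    ext i
    fin_cases i
    · simpa [hP] using h0.symm
    · simpa [hQ] using h1.symm
    · simpa [hN] using h2.symm
  obtain ⟨t, rfl⟩ := LinearMap.surjective_of_injective hinj w
  obtain ⟨h0, h1, h2⟩ := hcoef t
  rw [h0, h1, h2, hL]
  field_simp

/-! ### The spherical model -/

lemma tangentProj_smul_self {c r : ℝ} (hc : c ≠ 0) {p : R3} (hp : p ∈ spaceForm c) :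
    tangentProj c p (r • p) = 0 := by
  have h := form_normalVec_ne_zero hp
  rw [normalVec_eq_self hc] at h
  rw [tangentProj, normalVec_eq_self hc, form_smul_right, mul_div_cancel_right₀ _ h, sub_self]

lemma contDiff_form_left (c : ℝ) (N : R3) : ContDiff ℝ ∞ fun w => form c w N := by
  unfold form
  fun_prop

/-- The circle `cos (k t) A + sin (k t) B`. -/
def circle (k : ℝ) (A B : R3) (t : ℝ) : R3 := Real.cos (k * t) • A + Real.sin (k * t) • B

lemma deriv_circle (k : ℝ) (A B : R3) : deriv (circle k A B) = circle k (k • B) (-(k • A)) := by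
  funext t
  have hk : HasDerivAt (fun t : ℝ => k * t) k t := by simpa using (hasDerivAt_id t).const_mul k
  have h : HasDerivAt (circle k A B) _ t := (hk.cos.smul_const A).add (hk.sin.smul_const B)
  rw [h.deriv, circle]
  module

lemma contDiff_circle (k : ℝ) (A B : R3) : ContDiff ℝ ∞ (circle k A B) := by
  unfold circle
  fun_prop

lemma circle_smul (k r : ℝ) (A B : R3) (t : ℝ) :
    circle k (r • A) (r • B) t = r • circle k A B t := by
  simp only [circle]
  module

lemma form_circle (c k : ℝ) (A B : R3) (t : ℝ) (hAB : form c A B = 0)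
    (h : form c A A = form c B B) : form c (circle k A B t) (circle k A B t) = form c A A := by
  have hBA := (form_comm c B A).trans hAB
  simp only [circle, form_add_left, form_add_right, form_smul_left, form_smul_right, hAB, hBA, ← h]
  linear_combination form c A A * Real.sin_sq_add_cos_sq (k * t)

/-- The acceleration is `-k² γ`, which is normal to the sphere, and the squared speed is `k² / c =
s²`. -/
lemma isGeodesicOfSpeed_circle {c s k : ℝ} {A B : R3} (hc : 0 < c) (hs : 0 ≤ s)
    (hk : k ^ 2 = c * s ^ 2) (hA : form c A A = 1 / c) (hB : form c B B = 1 / c)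
    (hAB : form c A B = 0) : IsGeodesicOfSpeed c s (circle k A B) := by
  have hmem : ∀ t, circle k A B t ∈ spaceForm c := fun t =>
    mem_spaceForm_of_pos hc (by rw [form_circle c k A B t hAB (hA.trans hB.symm), hA])
  have hBA := (form_comm c B A).trans hAB
  refine ⟨contDiff_circle k A B, hmem, fun t => ?_, fun t => ?_⟩
  · have : deriv (deriv (circle k A B)) t = (-k ^ 2) • circle k A B t := by
      rw [deriv_circle, deriv_circle]
      simp only [circle]
      module
    rw [this, tangentProj_smul_self hc.ne' (hmem t)]
  · rw [deriv_circle, ← neg_smul, form_circle]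
    · rw [form_smul_left, form_smul_right, hB]
      have : k * (k * (1 / c)) = s ^ 2 := by field_simp; linarith
      rw [this, Real.sqrt_sq hs]
    · rw [form_smul_left, form_smul_right, hBA]; simp
    · simp only [form_smul_left, form_smul_right, hA, hB]; ring

/-- Position and velocity turn together in the plane of `A` and `B`, so their cross product is
constant: the orthogonal geodesics of the model all leave in the directions given by one vector `N`.
-/
lemma crossProduct_circle (k : ℝ) (A B : R3) (t : ℝ) :
    crossProduct (circle k A B t) (deriv (circle k A B) t) = k • crossProduct A B := by
  rw [deriv_circle]
  have h := Real.sin_sq_add_cos_sq (k * t)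
  ext i
  fin_cases i <;> simp [circle, cross_apply]
  · linear_combination k * (A 1 * B 2 - A 2 * B 1) * h
  · linear_combination k * (A 2 * B 0 - A 0 * B 2) * h
  · linear_combination k * (A 0 * B 1 - A 1 * B 0) * h

/-- The part of the sphere parametrized by the coordinates `(u, v)` of the spherical model. -/
def sphereParam (k : ℝ) (P Q N : R3) (x : R2) : R3 :=
  Real.cos (k * x 0) • circle k P Q (x 1) + Real.sin (k * x 0) • N

lemma differentiable_sphereParam (k : ℝ) (P Q N : R3) :
    Differentiable ℝ (sphereParam k P Q N) := by
  unfold sphereParam circle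
  fun_prop

lemma sphericalModel_circle {c₁ c₂ : ℝ} (h₁ : 0 < c₁) (h₂ : 0 < c₂) (P Q : R3) (x : R2) :
    sphericalModel c₁ c₂ (circle √(c₁ * c₂ / (c₁ + c₂)) P Q)
      (circle √(c₁ * c₂ / (c₁ + c₂)) (√(c₁ / c₂) • P) (√(c₁ / c₂) • Q)) (x 0) (x 1) =
    (sphereParam √(c₁ * c₂ / (c₁ + c₂)) P Q (√c₁ • crossProduct P Q) x,
      √(c₁ / c₂) • sphereParam √(c₁ * c₂ / (c₁ + c₂)) P Q (√c₁ • crossProduct P Q) x) := by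
  have e1 : √((c₁ + c₂) / c₂) * √(c₁ * c₂ / (c₁ + c₂)) = √c₁ := by
    rw [← Real.sqrt_mul (by positivity)]; congr 1; field_simp
  -- The cross product of the scaled vectors carries `√(c₁ / c₂)` twice: one factor is absorbed
  -- here, the other is the scaling of the second component.
  have e2 : √((c₁ + c₂) / c₁) * √(c₁ * c₂ / (c₁ + c₂)) * √(c₁ / c₂) = √c₁ := by
    rw [← Real.sqrt_mul (by positivity), ← Real.sqrt_mul (by positivity)]; congr 1; field_simp
  rw [sphericalModel, crossProduct_circle, crossProduct_circle, circle_smul, ← e1]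
  refine Prod.ext ?_ ?_
  · simp only [sphereParam]
    module
  · rw [e1, ← e2]
    simp only [sphereParam, map_smul, LinearMap.smul_apply]
    module

/-- The inverse of `sphereParam`. -/
def sphereCoord (c k : ℝ) (Q N : R3) (w : R3) : R2 :=
  !₂[Real.arcsin (c * form c w N) / k,
    Real.arcsin (c * form c w Q / √(1 - (c * form c w N) ^ 2)) / k]

section SphereCoord

variable {c k : ℝ} {P Q N : R3}

/-- The first two conditions keep the arguments of `arcsin` where it is smooth; the third selects
the hemisphere around `P`. At `P` both arguments are zero. -/
lemma eventually_sphereCoord (hPQ : form c P Q = 0) (hPN : form c P N = 0)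
    (hP : 0 < c * form c P P) : ∀ᶠ w in nhds P, c * form c w N ∈ Set.Ioo (-1) 1 ∧
      c * form c w Q / √(1 - (c * form c w N) ^ 2) ∈ Set.Ioo (-1) 1 ∧ 0 < c * form c w P := by
  have hz : ContinuousAt (fun w => c * form c w N) P :=
    ((contDiff_form_left c N).continuous.const_mul c).continuousAt
  have hy : ContinuousAt (fun w => c * form c w Q) P :=
    ((contDiff_form_left c Q).continuous.const_mul c).continuousAt
  have hx : ContinuousAt (fun w => c * form c w P) P :=
    ((contDiff_form_left c P).continuous.const_mul c).continuousAt
  have hq : ContinuousAt (fun w => c * form c w Q / √(1 - (c * form c w N) ^ 2)) P :=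
    hy.div (Real.continuous_sqrt.continuousAt.comp (continuousAt_const.sub (hz.pow 2)))
      (by simp [hPN])
  exact (hz.eventually_mem (Ioo_mem_nhds (by simp [hPN]) (by simp [hPN]))).and
    ((hq.eventually_mem (Ioo_mem_nhds (by simp [hPQ]) (by simp [hPQ]))).and
      (hx.eventually (lt_mem_nhds hP)))

lemma contDiffAt_sphereCoord {w : R3} (hz : c * form c w N ∈ Set.Ioo (-1) 1)
    (hy : c * form c w Q / √(1 - (c * form c w N) ^ 2) ∈ Set.Ioo (-1) 1) :
    ContDiffAt ℝ ∞ (sphereCoord c k Q N) w := by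
  have dz : ContDiffAt ℝ ∞ (fun w => c * form c w N) w :=
    contDiffAt_const.mul (contDiff_form_left c N).contDiffAt
  have dy : ContDiffAt ℝ ∞ (fun w => c * form c w Q) w :=
    contDiffAt_const.mul (contDiff_form_left c Q).contDiffAt
  have hpos : 0 < 1 - (c * form c w N) ^ 2 := by nlinarith [hz.1, hz.2]
  have dq : ContDiffAt ℝ ∞ (fun w => c * form c w Q / √(1 - (c * form c w N) ^ 2)) w :=
    dy.div ((contDiffAt_const.sub (dz.pow 2)).sqrt hpos.ne') (Real.sqrt_pos.2 hpos).ne'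
  have h0 := ((Real.contDiffAt_arcsin hz.1.ne' hz.2.ne).comp w dz).div_const k
  have h1 := ((Real.contDiffAt_arcsin hy.1.ne' hy.2.ne).comp w dq).div_const k
  rw [contDiffAt_piLp]
  intro i
  fin_cases i
  exacts [h0, h1]

lemma sphereParam_sphereCoord (hc : 0 < c) (hk : k ≠ 0) (hP : form c P P = 1 / c)
    (hQ : form c Q Q = 1 / c) (hN : form c N N = 1 / c) (hPQ : form c P Q = 0)
    (hPN : form c P N = 0) (hQN : form c Q N = 0) {w : R3} (hw : w ∈ spaceForm c)
    (hz : c * form c w N ∈ Set.Ioo (-1) 1)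
    (hy : c * form c w Q / √(1 - (c * form c w N) ^ 2) ∈ Set.Ioo (-1) 1)
    (hx : 0 < c * form c w P) : sphereParam k P Q N (sphereCoord c k Q N w) = w := by
  have hne : 1 / c ≠ 0 := by positivity
  have hexp := eq_sum_of_orthogonal (hP ▸ hne) (hQ ▸ hne) (hN ▸ hne) hPQ hPN hQN w
  simp only [hP, hQ, hN, div_div_eq_mul_div, div_one] at hexp
  have hself := form_self_of_mem hc.ne' hw
  set x := form c w P
  set y := form c w Q
  set z := form c w N
  have hsum : (c * x) ^ 2 + (c * y) ^ 2 + (c * z) ^ 2 = 1 := by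
    have h1 : form c w w = x * c * x + y * c * y + z * c * z := by
      conv_lhs => arg 3; rw [hexp]
      simp only [form_add_right, form_smul_right]
      rfl
    rw [h1] at hself
    field_simp at hself
    linarith
  have hpos : 0 < 1 - (c * z) ^ 2 := by nlinarith [hz.1, hz.2]
  set m := √(1 - (c * z) ^ 2)
  have hm : 0 < m := Real.sqrt_pos.2 hpos
  have hmm : m ^ 2 = 1 - (c * z) ^ 2 := Real.sq_sqrt hpos.le
  -- Here `m` is the cosine of the latitude. The sign of the root is right because `c * x` is
  -- positive.
  have hcos : √(1 - (c * y / m) ^ 2) = c * x / m := by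
    rw [← Real.sqrt_sq (div_pos hx hm).le]
    congr 1
    field_simp
    linarith
  have c0 : sphereCoord c k Q N w 0 = Real.arcsin (c * z) / k := rfl
  have c1 : sphereCoord c k Q N w 1 = Real.arcsin (c * y / m) / k := rfl
  rw [sphereParam, circle, c0, c1, mul_div_cancel₀ _ hk, mul_div_cancel₀ _ hk, Real.cos_arcsin,
    Real.cos_arcsin, Real.sin_arcsin hz.1.le hz.2.le, Real.sin_arcsin hy.1.le hy.2.le, hcos]
  change m • _ + _ = _
  rw [smul_add, smul_smul, smul_smul, mul_div_cancel₀ _ hm.ne', mul_div_cancel₀ _ hm.ne']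
  conv_rhs => rw [hexp]
  simp only [mul_comm]

end SphereCoord

theorem isLocallyCongruentTo_sphericalModel {M : Type*} [TopologicalSpace M] [ChartedSpace R2 M]
    [IsManifold (𝓡 2) ∞ M] {c₁ c₂ : ℝ} {ψ : M → Amb} (h : IsImmersedSurface c₁ c₂ ψ) {lam : ℝ}
    (hf : ∀ (p : M) (X : TangentSpace (𝓡 2) p), tensorF c₁ c₂ ψ p X = lam • X)
    (hc₁ : 0 < c₁) (hc₂ : 0 < c₂) (h₁ : (1 + lam) / 2 ≠ 0) (h₂ : (1 - lam) / 2 ≠ 0)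
    (hca : c₁ * ((1 + lam) / 2) = c₂ * ((1 - lam) / 2)) :
    IsLocallyCongruentTo c₁ c₂ ψ (sphericalModel c₁ c₂) := by
  intro p
  obtain ⟨H₁, -⟩ := isHomothetic_localRep h hf p
  have hx := mem_extChartAt_target (I := 𝓡 2) p
  have hPmem := (h.mem p).1
  -- Any nonzero tangent vector at `P` will do for the initial direction `Q` of the geodesic `α`.
  have hv : fderiv ℝ (fun x => (localRep ψ p x).1) (extChartAt (𝓡 2) p p) (e 0) ≠ 0 := by
    intro h0
    have := (injective_iff_map_eq_zero _).1 (H₁.injective h₁ hx) (e 0) h0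
    simpa [e] using congrArg (fun X : R2 => X 0) this
  have ht := H₁.isTangent hx (e 0)
  simp only [localRep_extChartAt] at ht
  obtain ⟨Q, hPQ, hQ⟩ := exists_tangent_of_form_eq hc₁.ne' hPmem ht hv
  rw [abs_of_pos hc₁, ← one_div] at hQ
  set P := (ψ p).1
  have hP := form_self_of_mem hc₁.ne' hPmem
  set N := √c₁ • crossProduct P Q with hNdef
  have hPN : form c₁ P N = 0 := by
    simp only [hNdef, form_smul_right]
    simp [form, hc₁.not_gt, cross_apply]
    right
    ring
  have hQN : form c₁ Q N = 0 := by
    simp only [hNdef, form_smul_right]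
    simp [form, hc₁.not_gt, cross_apply]
    right
    ring
  have hN : form c₁ N N = 1 / c₁ := by
    have h1 : form c₁ (crossProduct P Q) (crossProduct P Q) =
        form c₁ P P * form c₁ Q Q - form c₁ P Q ^ 2 := by
      simp [form, hc₁.not_gt, cross_apply]
      ring
    rw [hNdef, form_smul_left, form_smul_right, ← mul_assoc, Real.mul_self_sqrt hc₁.le, h1, hP,
      hQ, hPQ]
    field_simp
    simp
  set k := √(c₁ * c₂ / (c₁ + c₂)) with hk
  have hk0 : k ≠ 0 := (Real.sqrt_pos.2 (by positivity)).ne'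
  have hk2 : k ^ 2 = c₁ * c₂ / (c₁ + c₂) := Real.sq_sqrt (by positivity)
  have hev := eventually_sphereCoord hPQ hPN (by rw [hP]; positivity)
  obtain ⟨χ, hχ, hp, τ₁, τ₂, hτ₁, hτ₂, hq⟩ := exists_chart_eq_parametrization h hf
    (mul_pos hc₁ hc₂) h₁ h₂ hca p (F := sphereCoord c₁ k Q N) (Ψ := sphereParam k P Q N)
    (hev.mono fun w hw => contDiffAt_sphereCoord hw.1 hw.2.1) (differentiable_sphereParam k P Q N)
    (hev.mono fun w hw hwm => sphereParam_sphereCoord hc₁ hk0 hP hQ hN hPQ hPN hQN hwm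
      hw.1 hw.2.1 hw.2.2)
  refine ⟨χ, hχ, hp, τ₁, τ₂, hτ₁, hτ₂, circle k P Q,
    circle k (√(c₁ / c₂) • P) (√(c₁ / c₂) • Q), ?_, ?_, fun q hqs => ?_⟩
  · refine isGeodesicOfSpeed_circle hc₁ (Real.sqrt_nonneg _) ?_ hP hQ hPQ
    rw [hk2, Real.sq_sqrt (by positivity)]
    field_simp
  · have hs : ∀ v w, form c₂ (√(c₁ / c₂) • v) (√(c₁ / c₂) • w) = c₁ / c₂ * form c₁ v w := by
      intro v w
      rw [form_smul_left, form_smul_right, ← mul_assoc, Real.mul_self_sqrt (by positivity),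
        form_eq_form (mul_pos hc₁ hc₂)]
    refine isGeodesicOfSpeed_circle hc₂ (Real.sqrt_nonneg _) ?_ ?_ ?_ ?_
    · rw [hk2, Real.sq_sqrt (by positivity)]
      field_simp
    · rw [hs, hP]; field_simp
    · rw [hs, hQ]; field_simp
    · rw [hs, hPQ, mul_zero]
  · rw [hq q hqs, sphericalModel_circle hc₁ hc₂]

/-! ### The hyperbolic model -/

/-- The branch `cosh (k t) A + sinh (k t) B` of a hyperbola. -/
def hyperbola (k : ℝ) (A B : R3) (t : ℝ) : R3 := Real.cosh (k * t) • A + Real.sinh (k * t) • B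

lemma deriv_hyperbola (k : ℝ) (A B : R3) :
    deriv (hyperbola k A B) = hyperbola k (k • B) (k • A) := by
  funext t
  have hk : HasDerivAt (fun t : ℝ => k * t) k t := by simpa using (hasDerivAt_id t).const_mul k
  have h : HasDerivAt (hyperbola k A B) _ t := (hk.cosh.smul_const A).add (hk.sinh.smul_const B)
  rw [h.deriv, hyperbola]
  module

lemma contDiff_hyperbola (k : ℝ) (A B : R3) : ContDiff ℝ ∞ (hyperbola k A B) := by
  have hk : ContDiff ℝ ∞ fun t : ℝ => k * t := contDiff_const.mul contDiff_id
  exact (hk.cosh.smul contDiff_const).add (hk.sinh.smul contDiff_const)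

lemma hyperbola_smul (k r : ℝ) (A B : R3) (t : ℝ) :
    hyperbola k (r • A) (r • B) t = r • hyperbola k A B t := by
  simp only [hyperbola]
  module

lemma form_hyperbola (c k : ℝ) (A B : R3) (t : ℝ) (hAB : form c A B = 0)
    (h : form c B B = -form c A A) :
    form c (hyperbola k A B t) (hyperbola k A B t) = form c A A := by
  have hBA := (form_comm c B A).trans hAB
  simp only [hyperbola, form_add_left, form_add_right, form_smul_left, form_smul_right, hAB, hBA, h]
  linear_combination form c A A * Real.cosh_sq_sub_sinh_sq (k * t)

/-- The acceleration is `k² γ`, again normal. The curve stays on the upper sheet because its product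
with `A` is `cosh (k t) / c < 0`. -/
lemma isGeodesicOfSpeed_hyperbola {c s k : ℝ} {A B : R3} (hc : c < 0) (hs : 0 ≤ s)
    (hk : k ^ 2 = -c * s ^ 2) (hAmem : A ∈ spaceForm c) (hB : form c B B = -(1 / c))
    (hAB : form c A B = 0) : IsGeodesicOfSpeed c s (hyperbola k A B) := by
  have hA := form_self_of_mem hc.ne hAmem
  have hmem : ∀ t, hyperbola k A B t ∈ spaceForm c := by
    intro t
    refine mem_spaceForm_of_form_neg hc hAmem ?_ ?_
    · rw [form_hyperbola c k A B t hAB (by rw [hA, hB]), hA]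
    · rw [hyperbola, form_add_right, form_smul_right, form_smul_right, hAB, hA, mul_zero, add_zero]
      exact mul_neg_of_pos_of_neg (Real.cosh_pos _) (one_div_neg.2 hc)
  have hBA := (form_comm c B A).trans hAB
  refine ⟨contDiff_hyperbola k A B, hmem, fun t => ?_, fun t => ?_⟩
  · have : deriv (deriv (hyperbola k A B)) t = (k ^ 2) • hyperbola k A B t := by
      rw [deriv_hyperbola, deriv_hyperbola]
      simp only [hyperbola]
      module
    rw [this, tangentProj_smul_self hc.ne (hmem t)]
  · rw [deriv_hyperbola, form_hyperbola]
    · rw [form_smul_left, form_smul_right, hB]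
      have hc0 := hc.ne
      have : k * (k * -(1 / c)) = s ^ 2 := by field_simp; linarith
      rw [this, Real.sqrt_sq hs]
    · rw [form_smul_left, form_smul_right, hBA]; simp
    · simp only [form_smul_left, form_smul_right, hA, hB]; ring

/-- Position and velocity move by a boost of the plane of `A` and `B`, which has determinant one. -/
lemma lorentzCross_hyperbola (k : ℝ) (A B : R3) (t : ℝ) :
    lorentzCross (hyperbola k A B t) (deriv (hyperbola k A B) t) = k • lorentzCross A B := by
  rw [deriv_hyperbola]
  have h := Real.cosh_sq_sub_sinh_sq (k * t)
  ext i
  fin_cases i <;> simp [hyperbola, lorentzCross]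
  · linear_combination -(k * (A 1 * B 2 - A 2 * B 1)) * h
  · linear_combination k * (A 2 * B 0 - A 0 * B 2) * h
  · linear_combination k * (A 0 * B 1 - A 1 * B 0) * h

lemma lorentzCross_smul_smul (r s : ℝ) (A B : R3) :
    lorentzCross (r • A) (s • B) = (r * s) • lorentzCross A B := by
  ext i
  fin_cases i <;> simp [lorentzCross] <;> ring

/-- The hyperboloid parametrized by the coordinates `(u, v)` of the hyperbolic model. -/
def hyperboloidParam (k : ℝ) (P Q N : R3) (x : R2) : R3 :=
  Real.cosh (k * x 0) • hyperbola k P Q (x 1) + Real.sinh (k * x 0) • N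

lemma differentiable_hyperboloidParam (k : ℝ) (P Q N : R3) :
    Differentiable ℝ (hyperboloidParam k P Q N) := by
  unfold hyperboloidParam hyperbola
  fun_prop

lemma hyperbolicModel_hyperbola {c₁ c₂ : ℝ} (h₁ : c₁ < 0) (h₂ : c₂ < 0) (P Q : R3) (x : R2) :
    hyperbolicModel c₁ c₂ (hyperbola √(-(c₁ * c₂ / (c₁ + c₂))) P Q)
      (hyperbola √(-(c₁ * c₂ / (c₁ + c₂))) (√(c₁ / c₂) • P) (√(c₁ / c₂) • Q)) (x 0) (x 1) =
    (hyperboloidParam √(-(c₁ * c₂ / (c₁ + c₂))) P Q (√(-c₁) • lorentzCross P Q) x,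
      √(c₁ / c₂) • hyperboloidParam √(-(c₁ * c₂ / (c₁ + c₂))) P Q
        (√(-c₁) • lorentzCross P Q) x) := by
  have hs : c₁ + c₂ < 0 := add_neg h₁ h₂
  have n1 := h₁.ne
  have n2 := h₂.ne
  have ns := hs.ne
  have p1 : 0 ≤ (c₁ + c₂) / c₂ := div_nonneg_of_nonpos hs.le h₂.le
  have p2 : 0 ≤ (c₁ + c₂) / c₁ := div_nonneg_of_nonpos hs.le h₁.le
  have p3 : 0 ≤ -(c₁ * c₂ / (c₁ + c₂)) :=
    neg_nonneg.2 (div_nonpos_of_nonneg_of_nonpos (mul_pos_of_neg_of_neg h₁ h₂).le hs.le)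
  have e1 : √((c₁ + c₂) / c₂) * √(-(c₁ * c₂ / (c₁ + c₂))) = √(-c₁) := by
    rw [← Real.sqrt_mul p1]; congr 1; field_simp
  have e2 : √((c₁ + c₂) / c₁) * √(-(c₁ * c₂ / (c₁ + c₂))) * √(c₁ / c₂) = √(-c₁) := by
    rw [← Real.sqrt_mul p2, ← Real.sqrt_mul (mul_nonneg p2 p3)]; congr 1; field_simp
  rw [hyperbolicModel, lorentzCross_hyperbola, lorentzCross_hyperbola, hyperbola_smul,
    lorentzCross_smul_smul, ← e1]
  refine Prod.ext ?_ ?_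
  · simp only [hyperboloidParam]
    module
  · rw [e1, ← e2]
    simp only [hyperboloidParam]
    module

/-- The inverse of `hyperboloidParam`. -/
def hyperboloidCoord (c k : ℝ) (Q N : R3) (w : R3) : R2 :=
  !₂[Real.arsinh (-c * form c w N) / k,
    Real.arsinh (-c * form c w Q / √(1 + (-c * form c w N) ^ 2)) / k]

section HyperboloidCoord

variable {c k : ℝ} {P Q N : R3}

lemma contDiffAt_hyperboloidCoord (c k : ℝ) (Q N w : R3) :
    ContDiffAt ℝ ∞ (hyperboloidCoord c k Q N) w := by
  have dz : ContDiffAt ℝ ∞ (fun w => -c * form c w N) w :=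
    contDiffAt_const.mul (contDiff_form_left c N).contDiffAt
  have dy : ContDiffAt ℝ ∞ (fun w => -c * form c w Q) w :=
    contDiffAt_const.mul (contDiff_form_left c Q).contDiffAt
  have hpos : 0 < 1 + (-c * form c w N) ^ 2 := by positivity
  have dq : ContDiffAt ℝ ∞ (fun w => -c * form c w Q / √(1 + (-c * form c w N) ^ 2)) w :=
    dy.div ((contDiffAt_const.add (dz.pow 2)).sqrt hpos.ne') (Real.sqrt_pos.2 hpos).ne'
  have h0 := dz.arsinh.div_const k
  have h1 := dq.arsinh.div_const k
  rw [contDiffAt_piLp]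
  intro i
  fin_cases i
  exacts [h0, h1]

/-- Unlike on the sphere, these coordinates are global: `arsinh` is defined everywhere, and the sign
needed for the root in `hcosh` holds on the whole sheet by `form_neg_of_mem`. -/
lemma hyperboloidParam_hyperboloidCoord (hc : c < 0) (hk : k ≠ 0) (hPmem : P ∈ spaceForm c)
    (hQ : form c Q Q = -(1 / c)) (hN : form c N N = -(1 / c)) (hPQ : form c P Q = 0)
    (hPN : form c P N = 0) (hQN : form c Q N = 0) {w : R3} (hw : w ∈ spaceForm c) :
    hyperboloidParam k P Q N (hyperboloidCoord c k Q N w) = w := by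
  have hP := form_self_of_mem hc.ne hPmem
  have hne : 1 / c ≠ 0 := (one_div_neg.2 hc).ne
  have hne' : -(1 / c) ≠ 0 := neg_ne_zero.2 hne
  have hexp := eq_sum_of_orthogonal (hP ▸ hne) (hQ ▸ hne') (hN ▸ hne') hPQ hPN hQN w
  simp only [hP, hQ, hN, div_neg, div_div_eq_mul_div, div_one] at hexp
  have hself := form_self_of_mem hc.ne hw
  have hx : 0 < c * form c w P := mul_pos_of_neg_of_neg hc (form_neg_of_mem hc hw hPmem)
  set x := form c w P
  set y := form c w Q
  set z := form c w N
  have hsum : (c * x) ^ 2 - (-c * y) ^ 2 - (-c * z) ^ 2 = 1 := by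
    have h1 : form c w w = x * c * x + -(y * c) * y + -(z * c) * z := by
      conv_lhs => arg 3; rw [hexp]
      simp only [form_add_right, form_smul_right]
      rfl
    rw [h1] at hself
    have hc0 := hc.ne
    field_simp at hself
    linarith
  have hpos : 0 < 1 + (-c * z) ^ 2 := by positivity
  set m := √(1 + (-c * z) ^ 2) with hmdef
  have hm : 0 < m := Real.sqrt_pos.2 hpos
  have hmm : m ^ 2 = 1 + (-c * z) ^ 2 := Real.sq_sqrt hpos.le
  have hcosh : √(1 + (-c * y / m) ^ 2) = c * x / m := by
    rw [← Real.sqrt_sq (div_pos hx hm).le]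
    congr 1
    field_simp
    linarith
  have c0 : hyperboloidCoord c k Q N w 0 = Real.arsinh (-c * z) / k := rfl
  have c1 : hyperboloidCoord c k Q N w 1 = Real.arsinh (-c * y / m) / k := rfl
  rw [hyperboloidParam, hyperbola, c0, c1, mul_div_cancel₀ _ hk, mul_div_cancel₀ _ hk,
    Real.cosh_arsinh, Real.cosh_arsinh, Real.sinh_arsinh, Real.sinh_arsinh, hcosh, ← hmdef,
    smul_add, smul_smul, smul_smul, mul_div_cancel₀ _ hm.ne', mul_div_cancel₀ _ hm.ne']
  conv_rhs => rw [hexp]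
  simp only [mul_comm, neg_mul]

end HyperboloidCoord

theorem isLocallyCongruentTo_hyperbolicModel {M : Type*} [TopologicalSpace M] [ChartedSpace R2 M]
    [IsManifold (𝓡 2) ∞ M] {c₁ c₂ : ℝ} {ψ : M → Amb} (h : IsImmersedSurface c₁ c₂ ψ) {lam : ℝ}
    (hf : ∀ (p : M) (X : TangentSpace (𝓡 2) p), tensorF c₁ c₂ ψ p X = lam • X)
    (hc₁ : c₁ < 0) (hc₂ : c₂ < 0) (h₁ : (1 + lam) / 2 ≠ 0) (h₂ : (1 - lam) / 2 ≠ 0)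
    (hca : c₁ * ((1 + lam) / 2) = c₂ * ((1 - lam) / 2)) :
    IsLocallyCongruentTo c₁ c₂ ψ (hyperbolicModel c₁ c₂) := by
  intro p
  have hcc := mul_pos_of_neg_of_neg hc₁ hc₂
  have hs : c₁ + c₂ < 0 := add_neg hc₁ hc₂
  have n1 := hc₁.ne
  have n2 := hc₂.ne
  have ns := hs.ne
  obtain ⟨H₁, -⟩ := isHomothetic_localRep h hf p
  have hx := mem_extChartAt_target (I := 𝓡 2) p
  have hPmem := (h.mem p).1
  have hv : fderiv ℝ (fun x => (localRep ψ p x).1) (extChartAt (𝓡 2) p p) (e 0) ≠ 0 := by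
    intro h0
    have := (injective_iff_map_eq_zero _).1 (H₁.injective h₁ hx) (e 0) h0
    simpa [e] using congrArg (fun X : R2 => X 0) this
  have ht := H₁.isTangent hx (e 0)
  simp only [localRep_extChartAt] at ht
  obtain ⟨Q, hPQ, hQ⟩ := exists_tangent_of_form_eq n1 hPmem ht hv
  rw [abs_of_neg hc₁, inv_neg, ← one_div] at hQ
  set P := (ψ p).1
  have hP := form_self_of_mem n1 hPmem
  set N := √(-c₁) • lorentzCross P Q with hNdef
  have hPN : form c₁ P N = 0 := by
    simp only [hNdef, form_smul_right]
    simp [form, hc₁, lorentzCross]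
    right
    ring
  have hQN : form c₁ Q N = 0 := by
    simp only [hNdef, form_smul_right]
    simp [form, hc₁, lorentzCross]
    right
    ring
  have hN : form c₁ N N = -(1 / c₁) := by
    -- Lagrange's identity changes sign in Lorentzian signature, so `N` is spacelike.
    have h1 : form c₁ (lorentzCross P Q) (lorentzCross P Q) =
        form c₁ P Q ^ 2 - form c₁ P P * form c₁ Q Q := by
      simp [form, hc₁, lorentzCross]
      ring
    rw [hNdef, form_smul_left, form_smul_right, ← mul_assoc,
      Real.mul_self_sqrt (neg_nonneg.2 hc₁.le), h1, hP, hQ, hPQ]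
    field_simp
    simp
  have hkpos : 0 < -(c₁ * c₂ / (c₁ + c₂)) := neg_pos.2 (div_neg_of_pos_of_neg hcc hs)
  set k := √(-(c₁ * c₂ / (c₁ + c₂))) with hk
  have hk0 : k ≠ 0 := (Real.sqrt_pos.2 hkpos).ne'
  have hk2 : k ^ 2 = -(c₁ * c₂ / (c₁ + c₂)) := Real.sq_sqrt hkpos.le
  obtain ⟨χ, hχ, hp, τ₁, τ₂, hτ₁, hτ₂, hq⟩ := exists_chart_eq_parametrization h hf
    hcc h₁ h₂ hca p (F := hyperboloidCoord c₁ k Q N) (Ψ := hyperboloidParam k P Q N)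
    (Filter.Eventually.of_forall (contDiffAt_hyperboloidCoord c₁ k Q N))
    (differentiable_hyperboloidParam k P Q N)
    (Filter.Eventually.of_forall fun w hwm =>
      hyperboloidParam_hyperboloidCoord hc₁ hk0 hPmem hQ hN hPQ hPN hQN hwm)
  refine ⟨χ, hχ, hp, τ₁, τ₂, hτ₁, hτ₂, hyperbola k P Q,
    hyperbola k (√(c₁ / c₂) • P) (√(c₁ / c₂) • Q), ?_, ?_, fun q hqs => ?_⟩
  · refine isGeodesicOfSpeed_hyperbola hc₁ (Real.sqrt_nonneg _) ?_ hPmem hQ hPQ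
    rw [hk2, Real.sq_sqrt (div_nonneg_of_nonpos hc₂.le hs.le)]
    field_simp
  · have hs' : ∀ v w, form c₂ (√(c₁ / c₂) • v) (√(c₁ / c₂) • w) = c₁ / c₂ * form c₁ v w := by
      intro v w
      rw [form_smul_left, form_smul_right, ← mul_assoc,
        Real.mul_self_sqrt (div_nonneg_of_nonpos hc₁.le hc₂.le), form_eq_form hcc]
    refine isGeodesicOfSpeed_hyperbola hc₂ (Real.sqrt_nonneg _) ?_
      (smul_mem_spaceForm hcc hPmem) ?_ ?_
    · rw [hk2, Real.sq_sqrt (div_nonneg_of_nonpos hc₁.le hs.le)]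
      field_simp
    · rw [hs', hQ]; field_simp
    · rw [hs', hPQ, mul_zero]
  · rw [hq q hqs, hyperbolicModel_hyperbola hc₁ hc₂]

/-! ### Slices -/

/-- A component of a surface which is an immersion is locally open in the space form. -/
lemma exists_isOpen_inter_subset_image {M : Type*} [TopologicalSpace M] [ChartedSpace R2 M]
    {c a : ℝ} {G : R2 → Matrix (Fin 2) (Fin 2) ℝ} {f : M → R3} {p : M}
    (h : IsHomothetic c a G (fun x => f ((extChartAt (𝓡 2) p).symm x))
      (extChartAt (𝓡 2) p).target) (ha : a ≠ 0) {U : Set M} (hU : U ∈ nhds p) :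
    ∃ V, IsOpen V ∧ f p ∈ V ∧ V ∩ spaceForm c ⊆ f '' U := by
  have hW : (extChartAt (𝓡 2) p).symm ⁻¹' U ∈ nhds (extChartAt (𝓡 2) p p) :=
    (continuousAt_extChartAt_symm (I := 𝓡 2) p).preimage_mem_nhds
      (by rwa [extChartAt_to_inv])
  obtain ⟨V, hV, hpV, hsub⟩ :=
    h.exists_isOpen_inter_subset_image ha (mem_extChartAt_target p) hW
  rw [extChartAt_to_inv] at hpV
  refine ⟨V, hV, hpV, fun v hv => ?_⟩
  obtain ⟨x, hx, rfl⟩ := hsub hv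
  exact ⟨_, hx, rfl⟩

/-- A map to `S` which is locally open is open. -/
lemma isOpenPart_of_forall {M : Type*} [TopologicalSpace M] {ψ : M → Amb} {S : Set Amb} (hS : ∀ p, ψ p ∈ S)
    (h : ∀ p, ∀ U ∈ nhds p, ∃ V : Set Amb, IsOpen V ∧ ψ p ∈ V ∧ V ∩ S ⊆ ψ '' U) :
    IsOpenPart ψ S := by
  intro U hU
  choose! V hVo hpV hV using fun p (hp : p ∈ U) => h p U (hU.mem_nhds hp)
  refine ⟨⋃ p ∈ U, V p, isOpen_biUnion hVo, Set.Subset.antisymm ?_ ?_⟩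
  · rintro _ ⟨p, hp, rfl⟩
    exact ⟨Set.mem_biUnion hp (hpV p hp), hS p⟩
  · rintro v ⟨hv, hvS⟩
    obtain ⟨p, hp, hvp⟩ := Set.mem_iUnion₂.1 hv
    exact hV p hp ⟨hvp, hvS⟩

section Surface

variable {M : Type*} [TopologicalSpace M] [ChartedSpace R2 M] [IsManifold (𝓡 2) ∞ M]
  {c₁ c₂ : ℝ} {ψ : M → Amb}

lemma gaussCurvature_eq_fst (h : IsImmersedSurface c₁ c₂ ψ) {lam : ℝ}
    (hf : ∀ (p : M) (X : TangentSpace (𝓡 2) p), tensorF c₁ c₂ ψ p X = lam • X)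
    (ha : (1 + lam) / 2 ≠ 0) (p : M) : gaussCurvature c₁ c₂ ψ p = c₁ * ((1 + lam) / 2) :=
  (isHomothetic_localRep h hf p).1.curvature_eq ha (mem_extChartAt_target p)

lemma gaussCurvature_eq_snd (h : IsImmersedSurface c₁ c₂ ψ) {lam : ℝ}
    (hf : ∀ (p : M) (X : TangentSpace (𝓡 2) p), tensorF c₁ c₂ ψ p X = lam • X)
    (ha : (1 - lam) / 2 ≠ 0) (p : M) : gaussCurvature c₁ c₂ ψ p = c₂ * ((1 - lam) / 2) :=
  (isHomothetic_localRep h hf p).2.curvature_eq ha (mem_extChartAt_target p)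

/-- For `λ = 1` the second component has factor zero and is constant by connectedness, while the
first has factor one and is locally open. -/
theorem exists_isOpenPart_slice_fst [ConnectedSpace M] (h : IsImmersedSurface c₁ c₂ ψ)
    (hf : ∀ (p : M) (X : TangentSpace (𝓡 2) p), tensorF c₁ c₂ ψ p X = (1 : ℝ) • X) :
    ∃ p₂ ∈ spaceForm c₂, IsOpenPart ψ (spaceForm c₁ ×ˢ {p₂}) := by
  obtain ⟨p₀⟩ := (inferInstance : Nonempty M)
  have hconst : ∀ p, (ψ p).2 = (ψ p₀).2 := by
    refine fun p => eq_of_fderiv_eq_zero (f := fun q => (ψ q).2) (fun q x hx => ?_) p p₀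
    have H := (isHomothetic_localRep h hf q).2
    rw [sub_self, zero_div] at H
    exact ⟨H.differentiableAt hx, H.fderiv_eq_zero hx⟩
  refine ⟨(ψ p₀).2, (h.mem p₀).2,
    isOpenPart_of_forall (fun p => ⟨(h.mem p).1, hconst p⟩) fun p U hU => ?_⟩
  obtain ⟨V, hV, hpV, hsub⟩ := exists_isOpen_inter_subset_image (f := fun q => (ψ q).1)
    (isHomothetic_localRep h hf p).1 (by norm_num) hU
  refine ⟨V ×ˢ Set.univ, hV.prod isOpen_univ, ⟨hpV, trivial⟩, ?_⟩
  rintro ⟨v, w⟩ ⟨⟨hv, -⟩, hvS, hw⟩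
  obtain ⟨q, hq, rfl⟩ := hsub ⟨hv, hvS⟩
  exact ⟨q, hq, Prod.ext rfl ((hconst q).trans hw.symm)⟩

theorem exists_isOpenPart_slice_snd [ConnectedSpace M] (h : IsImmersedSurface c₁ c₂ ψ)
    (hf : ∀ (p : M) (X : TangentSpace (𝓡 2) p), tensorF c₁ c₂ ψ p X = (-1 : ℝ) • X) :
    ∃ p₁ ∈ spaceForm c₁, IsOpenPart ψ ({p₁} ×ˢ spaceForm c₂) := by
  obtain ⟨p₀⟩ := (inferInstance : Nonempty M)
  have hconst : ∀ p, (ψ p).1 = (ψ p₀).1 := by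
    refine fun p => eq_of_fderiv_eq_zero (f := fun q => (ψ q).1) (fun q x hx => ?_) p p₀
    have H := (isHomothetic_localRep h hf q).1
    rw [add_neg_cancel, zero_div] at H
    exact ⟨H.differentiableAt hx, H.fderiv_eq_zero hx⟩
  refine ⟨(ψ p₀).1, (h.mem p₀).1,
    isOpenPart_of_forall (fun p => ⟨hconst p, (h.mem p).2⟩) fun p U hU => ?_⟩
  obtain ⟨V, hV, hpV, hsub⟩ := exists_isOpen_inter_subset_image (f := fun q => (ψ q).2)
    (isHomothetic_localRep h hf p).2 (by norm_num) hU
  refine ⟨Set.univ ×ˢ V, isOpen_univ.prod hV, ⟨trivial, hpV⟩, ?_⟩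
  rintro ⟨v, w⟩ ⟨⟨-, hw⟩, hv, hwS⟩
  obtain ⟨q, hq, rfl⟩ := hsub ⟨hw, hwS⟩
  exact ⟨q, hq, Prod.ext ((hconst q).trans hv.symm) rfl⟩

end Surface

end ProductSurface

end

/-! ### The classification -/

theorem mainTheorem10 {M : Type*} [TopologicalSpace M] [ConnectedSpace M]
    [ChartedSpace ProductSurface.R2 M] [IsManifold (𝓡 2) ∞ M]
    (c₁ c₂ : ℝ) (hc : ¬ (c₁ = 0 ∧ c₂ = 0))
    (ψ : M → ProductSurface.Amb) (hψ : ProductSurface.IsImmersedSurface c₁ c₂ ψ)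
    (lam : ℝ) (hlam : lam ∈ Set.Icc (-1 : ℝ) 1)
    (hf : ∀ (p : M) (X : TangentSpace (𝓡 2) p),
      ProductSurface.tensorF c₁ c₂ ψ p X = lam • X) :
    ProductSurface.IsTotallyGeodesic c₁ c₂ ψ ∧
    ((lam = 1 ∧ (∀ p, ProductSurface.gaussCurvature c₁ c₂ ψ p = c₁) ∧
        ∃ p₂ ∈ ProductSurface.spaceForm c₂,
          ProductSurface.IsOpenPart ψ (ProductSurface.spaceForm c₁ ×ˢ {p₂})) ∨
      (lam = -1 ∧ (∀ p, ProductSurface.gaussCurvature c₁ c₂ ψ p = c₂) ∧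
        ∃ p₁ ∈ ProductSurface.spaceForm c₁,
          ProductSurface.IsOpenPart ψ ({p₁} ×ˢ ProductSurface.spaceForm c₂)) ∨
      (0 < c₁ * c₂ ∧ lam = (c₂ - c₁) / (c₁ + c₂) ∧
        (∀ p, ProductSurface.gaussCurvature c₁ c₂ ψ p = c₁ * c₂ / (c₁ + c₂)) ∧
        ((0 < c₁ ∧ 0 < c₂ ∧ ProductSurface.IsLocallyCongruentTo c₁ c₂ ψ
            (ProductSurface.sphericalModel c₁ c₂)) ∨
          (c₁ < 0 ∧ c₂ < 0 ∧ ProductSurface.IsLocallyCongruentTo c₁ c₂ ψ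
            (ProductSurface.hyperbolicModel c₁ c₂))))) := by
  open ProductSurface in
  refine ⟨isTotallyGeodesic_of_tensorF_eq hψ hf, ?_⟩
  by_cases h1 : lam = 1
  · subst h1
    refine Or.inl ⟨rfl, fun p => ?_, exists_isOpenPart_slice_fst hψ hf⟩
    rw [gaussCurvature_eq_fst hψ hf (by norm_num)]
    ring
  by_cases h2 : lam = -1
  · subst h2
    refine Or.inr (Or.inl ⟨rfl, fun p => ?_, exists_isOpenPart_slice_snd hψ hf⟩)
    rw [gaussCurvature_eq_snd hψ hf (by norm_num)]
    ring
  have ha₁ : 0 < (1 + lam) / 2 := by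
    have := lt_of_le_of_ne hlam.1 (Ne.symm h2)
    linarith
  have ha₂ : 0 < (1 - lam) / 2 := by
    have := lt_of_le_of_ne hlam.2 h1
    linarith
  obtain ⟨p₀⟩ := (inferInstance : Nonempty M)
  -- Both sides are the curvature of the same metric, computed from the two factors.
  have hca : c₁ * ((1 + lam) / 2) = c₂ * ((1 - lam) / 2) := by
    rw [← gaussCurvature_eq_fst hψ hf ha₁.ne' p₀, gaussCurvature_eq_snd hψ hf ha₂.ne' p₀]
  have hlamc : lam * (c₁ + c₂) = c₂ - c₁ := by linarith
  -- Both factors are positive, so `c₁` and `c₂` have the same sign; if one were zero, so would be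
  -- the other, which `hc` forbids.
  have hsign : (0 < c₁ ∧ 0 < c₂) ∨ (c₁ < 0 ∧ c₂ < 0) := by
    rcases lt_trichotomy c₁ 0 with h | h | h
    · refine Or.inr ⟨h, neg_of_mul_neg_left ?_ ha₂.le⟩
      rw [← hca]
      exact mul_neg_of_neg_of_pos h ha₁
    · refine absurd ⟨h, ?_⟩ hc
      rw [h, zero_mul] at hca
      exact (mul_eq_zero.1 hca.symm).resolve_right ha₂.ne'
    · refine Or.inl ⟨h, pos_of_mul_pos_left ?_ ha₂.le⟩
      rw [← hca]
      exact mul_pos h ha₁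
  have hsum : c₁ + c₂ ≠ 0 := by
    rcases hsign with ⟨h, h'⟩ | ⟨h, h'⟩
    · exact (add_pos h h').ne'
    · exact (add_neg h h').ne
  have hlam' : lam = (c₂ - c₁) / (c₁ + c₂) := by
    rw [eq_div_iff hsum, hlamc]
  refine Or.inr (Or.inr ⟨?_, hlam', fun p => ?_, ?_⟩)
  · rcases hsign with ⟨h, h'⟩ | ⟨h, h'⟩
    · exact mul_pos h h'
    · exact mul_pos_of_neg_of_neg h h'
  · rw [gaussCurvature_eq_fst hψ hf ha₁.ne', hlam']
    field_simp
    ring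
  · rcases hsign with ⟨h, h'⟩ | ⟨h, h'⟩
    · exact Or.inl ⟨h, h', isLocallyCongruentTo_sphericalModel hψ hf h h' ha₁.ne' ha₂.ne' hca⟩
    · exact Or.inr ⟨h, h', isLocallyCongruentTo_hyperbolicModel hψ hf h h' ha₁.ne' ha₂.ne' hca⟩
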